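/- Let $G$ be a torus of rank $r$ (a topological group isomorphic to $(S^1)^r$). Let $\Sigma_c$ be the poset of connected closed subgroups of $G$ and, for $K\in\Sigma_c$, let $\mathcal F/K$ be the set of closed subgroups of $G$ with identity component $K$. Let $\mathcal O_{\mathcal F/K}=\prod_{\tilde K\in\mathcal F/K}H^*(B(G/\tilde K);\mathbb Q)$. For $L\subseteq K$ the inflation map $\mathcal O_{\mathcal F/K}\to\mathcal O_{\mathcal F/L}$ sends $x$ to the family whose coordinate at $\tilde L$ is the inflation of $x(\tilde L\cdot K)$ along $G/\tilde L\to G/(\tilde L\cdot K)$. For a maximal proper connected closed subgroup $H$ and a nontrivial character $\alpha$ of $G$, let $c(\alpha)\in\mathcal O_{\mathcal F/H}$ have coordinate $c_1(\alpha)$ at $\tilde H$ if $\alpha|_{\tilde H}=1$, and $1$ otherwise. For $K\supseteq L$ let $\mathcal E_{K/L}\subseteq\mathcal O_{\mathcal F/L}$ be the multiplicative set generated by the inflations of all $c(\alpha)\in\mathcal O_{\mathcal F/H}$ with $L\subseteq H$ and $K\not\subseteq H$. Let $\mathcal R_c^p$ be the diagram of rings $(K\supseteq L)\mapsto \mathcal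 E_{K/L}^{-1}\mathcal O_{\mathcal F/L}$ on the poset of pairs $K\supseteq L$ in $\Sigma_c$, where $(K\supseteq L)\le(H\supseteq M)$ if $H\supseteq K\supseteq L\supseteq M$. Let $\mathcal R_c^f$ be the diagram of rings $(H_0\supset\cdots\supset H_s)\mapsto\mathcal E_{H_0/H_s}^{-1}\mathcal O_{\mathcal F/H_s}$ on the poset of flags (finite nonempty chains) in $\Sigma_c$, ordered by inclusion. In both cases the structure maps are induced by inflation and localization. Rings, products, localizations and modules are graded over an arbitrary abelian group $A$, with first Chern classes in an arbitrary fixed degree $c\in A$, and maps of modules preserve degrees; $A=\mathbb Z$, $c=2$ gives graded modules in the usual sense, and $A=0$ gives ungraded modules over the ungraded rings. An $\mathcal R_c^p$-module $M$ is *extended* ($e$) if for all $H\supseteq K\supseteq L$ the map $(H\supseteq K)\to(H\supseteq L)$ induces an isomorphism $\mathcal R_c^p(H\supseteq L)\otimes_{\mathcal R_c^p(H\supseteq K)}M(H\supseteq K)\cong M(H\supseteq L)$; it is *quasi-coherent* ($qc$) if for all $H\supseteq K\supseteq L$ the map $(K\supseteq L)\to(H\supseteq L)$ induces an isomorphism $\mathcal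 R_c^p(H\supseteq L)\otimes_{\mathcal R_c^p(K\supseteq L)}M(K\supseteq L)\cong M(H\supseteq L)$; it is $qce$ if it is both. An $\mathcal R_c^f$-module $M$ is *extended* if $\mathcal R_c^f(F)\otimes_{\mathcal R_c^f(H_0)}M(H_0)\cong M(F)$ for every flag $F$ with first term $H_0$, and $qce$ if $\mathcal R_c^f(F)\otimes_{\mathcal R_c^f(E)}M(E)\cong M(F)$ for all flags $E\subseteq F$ (in each case via the structure map). **Theorem.** The following inclusions of full subcategories have right adjoints: 1. $e\text{-}\mathcal R_c^p\text{-modules}\to\mathcal R_c^p\text{-modules}$ has a right adjoint $\Gamma^p_{cv}$; 2. $qce\text{-}\mathcal R_c^p\text{-modules}\to e\text{-}\mathcal R_c^p\text{-modules}$ has a right adjoint $\Gamma^p_{ch}$; 3. $qce\text{-}\mathcal R_c^p\text{-modules}\to \mathcal R_c^p\text{-modules}$ has the right adjoint $\Gamma^p_c=\Gamma^p_{ch}\Gamma^p_{cv}$; 4. $e\text{-}\mathcal R_c^f\text{-modules}\to\mathcal R_c^f\text{-modules}$ has a right adjoint $\Gamma^f_{cv}$; 5. $qce\text{-}\mathcal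 R_c^f\text{-modules}\to e\text{-}\mathcal R_c^f\text{-modules}$ has a right adjoint $\Gamma^f_{ch}$; 6. $qce\text{-}\mathcal R_c^f\text{-modules}\to \mathcal R_c^f\text{-modules}$ has the right adjoint $\Gamma^f_c=\Gamma^f_{ch}\Gamma^f_{cv}$. -/

import Mathlib

open CategoryTheory Opposite TensorProduct

namespace TorusModel

section Components
variable {G : Type} [CommGroup G] [TopologicalSpace G] [IsTopologicalGroup G] [CompactSpace G] [T2Space G]

theorem isClosed_sup (A B : Subgroup G) (hA : IsClosed (A : Set G)) (hB : IsClosed (B : Set G)) :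
    IsClosed ((A ⊔ B : Subgroup G) : Set G) := by
  rw [Subgroup.mul_normal]
  exact (hA.isCompact.mul hB.isCompact).isClosed

theorem mem_of_forall_open (A : Subgroup G) (hA : IsClosed (A : Set G)) (S : Set G) (hS : IsClosed S)
    (h : ∀ U : OpenSubgroup A, ∃ u ∈ U, (u : G) ∈ S) :
    ∃ u ∈ connectedComponentIn (A : Set G) 1, u ∈ S := by
  have : CompactSpace A := isCompact_iff_compactSpace.mp hA.isCompact
  let T : OpenSubgroup A → Set A := fun U => (U : Set A) ∩ (Subtype.val ⁻¹' S)
  have hT : (⋂ U, T U).Nonempty := by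
    apply IsCompact.nonempty_iInter_of_directed_nonempty_isCompact_isClosed T
    · intro U V
      exact ⟨U ⊓ V, fun x hx => ⟨hx.1.1, hx.2⟩, fun x hx => ⟨hx.1.2, hx.2⟩⟩
    · intro U
      obtain ⟨u, hu, hu'⟩ := h U
      exact ⟨u, hu, hu'⟩
    · intro U
      exact (U.isClosed.inter (hS.preimage continuous_subtype_val)).isCompact
    · intro U
      exact U.isClosed.inter (hS.preimage continuous_subtype_val)
  obtain ⟨u, hu⟩ := hT
  rw [Set.mem_iInter] at hu
  refine ⟨u, ?_, (hu ⊤).2⟩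
  rw [connectedComponentIn_eq_image A.one_mem]
  refine ⟨u, ?_, rfl⟩
  change u ∈ connectedComponent (1 : A)
  rw [connectedComponent_eq_iInter_isClopen, Set.mem_iInter]
  rintro ⟨W, hW, h1⟩
  obtain ⟨N, hN⟩ := IsTopologicalGroup.exist_openNormalSubgroup_sub_clopen_nhds_of_one hW h1
  exact hN (hu N.toOpenSubgroup).1

theorem component_sup (A B : Subgroup G) (hA : IsClosed (A : Set G)) (hB : IsClosed (B : Set G))
    (hBc : IsConnected (B : Set G)) (h : connectedComponentIn (A : Set G) 1 ⊆ B) :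
    connectedComponentIn ((A ⊔ B : Subgroup G) : Set G) 1 = B := by
  apply Set.Subset.antisymm
  · intro x hx
    have hxN : x ∈ A ⊔ B := connectedComponentIn_subset _ _ hx
    obtain ⟨y, hy, k, hk, rfl⟩ := Subgroup.mem_sup.mp hxN
    obtain ⟨u, hu, hu'⟩ := mem_of_forall_open A hA ((fun g => y⁻¹ * g) ⁻¹' (B : Set G))
      (hB.preimage (continuous_const_mul _)) (fun U => by
        have : CompactSpace A := isCompact_iff_compactSpace.mp hA.isCompact
        let U' : Subgroup G := U.toSubgroup.map A.subtype
        have hU'c : IsClosed (U' : Set G) := by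
          have : (U' : Set G) = Subtype.val '' (U : Set A) := rfl
          rw [this]
          exact (U.isClosed.isCompact.image continuous_subtype_val).isClosed
        let V : Subgroup ((A ⊔ B : Subgroup G)) := (U' ⊔ B).subgroupOf (A ⊔ B)
        have hVc : IsClosed (V : Set (A ⊔ B : Subgroup G)) :=
          (isClosed_sup U' B hU'c hB).preimage continuous_subtype_val
        have hU'A : U' ≤ A := by
          rintro _ ⟨a, -, rfl⟩
          exact a.2
        have hfi : V.FiniteIndex := by
          constructor
          change (U' ⊔ B).relIndex (A ⊔ B) ≠ 0
          have e : A ⊔ B = A ⊔ (U' ⊔ B) := by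
            rw [← sup_assoc, sup_eq_left.mpr hU'A]
          rw [e, Subgroup.relIndex_sup_right]
          have h1 : U'.relIndex A ≠ 0 := by
            have : U'.subgroupOf A = U.toSubgroup :=
              Subgroup.comap_map_eq_self_of_injective A.subtype_injective _
            rw [Subgroup.relIndex, this]
            exact Subgroup.FiniteIndex.index_ne_zero (H := U.toSubgroup)
              (self := Subgroup.finiteIndex_of_finite_quotient)
          exact fun h0 => h1 (Nat.eq_zero_of_zero_dvd (h0 ▸ Subgroup.relIndex_dvd_of_le_left A le_sup_left))
        have hVo : IsOpen (V : Set (A ⊔ B : Subgroup G)) :=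
          Subgroup.isOpen_of_isClosed_of_finiteIndex V hVc
        rw [connectedComponentIn_eq_image (A ⊔ B).one_mem] at hx
        obtain ⟨z, hz, hzx⟩ := hx
        have hzV : z ∈ (V : Set (A ⊔ B : Subgroup G)) :=
          IsClopen.connectedComponent_subset ⟨hVc, hVo⟩ V.one_mem hz
        have hyk : y * k ∈ U' ⊔ B := by
          have := Subgroup.mem_subgroupOf.mp hzV
          rwa [hzx] at this
        obtain ⟨u, ⟨u0, hu0, rfl⟩, b, hb, hub⟩ := Subgroup.mem_sup.mp hyk
        refine ⟨u0, hu0, ?_⟩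
        change y⁻¹ * (u0 : G) ∈ B
        have : y⁻¹ * (u0 : G) = k * b⁻¹ := by
          rw [eq_mul_inv_iff_mul_eq, mul_assoc, inv_mul_eq_iff_eq_mul]
          exact hub
        rw [this]
        exact B.mul_mem hk (B.inv_mem hb))
    have hy' : y ∈ B := by
      have h1 : u ∈ B := h hu
      have h2 : y⁻¹ * u ∈ B := hu'
      have := B.mul_mem h1 (B.inv_mem h2)
      simpa using this
    exact B.mul_mem hy' hk
  · exact hBc.isPreconnected.subset_connectedComponentIn B.one_mem
      (by exact_mod_cast (le_sup_right : B ≤ A ⊔ B))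

end Components

section Cohomology
variable (T : Type) [CommGroup T] [TopologicalSpace T]

/-- The rational cohomology ring `H^*(BT; ℚ)` of the classifying space of a torus `T`: the
polynomial ring, over `ℚ`, on the first Chern classes of the characters of `T`, i.e. the symmetric
algebra on (character group) `⊗ ℚ`. -/
abbrev CohomB : Type := SymmetricAlgebra ℚ (ℚ ⊗[ℤ] Additive (PontryaginDual T))

variable {T}

/-- The first Chern class of a character. -/
noncomputable def chern (χ : PontryaginDual T) : CohomB T :=
  SymmetricAlgebra.ι ℚ _ ((1 : ℚ) ⊗ₜ[ℤ] Additive.ofMul χ)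

/-- The part of degree `a` of `H^*(BT; ℚ)` when first Chern classes are put in degree `c`. -/
noncomputable def CohomB.degree {A : Type} [AddCommGroup A] (c a : A) : Submodule ℚ (CohomB T) :=
  ⨆ n : {n : ℕ // n • c = a},
    LinearMap.range (SymmetricAlgebra.ι ℚ (ℚ ⊗[ℤ] Additive (PontryaginDual T))) ^ (n : ℕ)

theorem CohomB.one_mem_degree {A : Type} [AddCommGroup A] (c : A) :
    (1 : CohomB T) ∈ CohomB.degree c 0 := by
  refine Submodule.mem_iSup_of_mem ⟨0, zero_smul _ _⟩ ?_
  simp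

theorem CohomB.mul_mem_degree {A : Type} [AddCommGroup A] {c a b : A} {x y : CohomB T}
    (hx : x ∈ CohomB.degree c a) (hy : y ∈ CohomB.degree c b) :
    x * y ∈ CohomB.degree c (a + b) := by
  have h : CohomB.degree (T := T) c a * CohomB.degree c b ≤ CohomB.degree c (a + b) := by
    unfold CohomB.degree
    rw [Submodule.iSup_mul, iSup_le_iff]
    intro n
    rw [Submodule.mul_iSup, iSup_le_iff]
    intro m
    rw [← pow_add]
    exact le_iSup_of_le ⟨n + m, by rw [add_smul, n.2, m.2]⟩ le_rfl
  exact h (Submodule.mul_mem_mul hx hy)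

variable {S U : Type} [CommGroup S] [TopologicalSpace S] [CommGroup U] [TopologicalSpace U]

/-- The map `H^*(BT; ℚ) → H^*(BS; ℚ)` induced by a continuous homomorphism `S → T`. -/
noncomputable def CohomB.map (f : S →ₜ* T) : CohomB T →ₐ[ℚ] CohomB S :=
  SymmetricAlgebra.lift (SymmetricAlgebra.ι ℚ _ ∘ₗ
    LinearMap.baseChange ℚ (PontryaginDual.map f).toMonoidHom.toAdditive.toIntLinearMap)

theorem CohomB.map_ι (f : S →ₜ* T) (x : ℚ ⊗[ℤ] Additive (PontryaginDual T)) :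
    CohomB.map f (SymmetricAlgebra.ι ℚ _ x) = SymmetricAlgebra.ι ℚ _
      (LinearMap.baseChange ℚ (PontryaginDual.map f).toMonoidHom.toAdditive.toIntLinearMap x) := by
  simp [CohomB.map]

theorem CohomB.map_id : CohomB.map (ContinuousMonoidHom.id T) = AlgHom.id ℚ (CohomB T) := by
  refine SymmetricAlgebra.algHom_ext (LinearMap.ext fun x => ?_)
  change CohomB.map _ (SymmetricAlgebra.ι ℚ _ x) = SymmetricAlgebra.ι ℚ _ x
  rw [CohomB.map_ι]
  congr 1
  induction x with
  | zero => simp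
  | add x y hx hy => rw [map_add, hx, hy]
  | tmul q χ => rfl

theorem CohomB.map_comp (g : S →ₜ* T) (f : U →ₜ* S) :
    (CohomB.map f).comp (CohomB.map g) = CohomB.map (g.comp f) := by
  refine SymmetricAlgebra.algHom_ext (LinearMap.ext fun x => ?_)
  change CohomB.map f (CohomB.map g (SymmetricAlgebra.ι ℚ _ x)) =
    CohomB.map _ (SymmetricAlgebra.ι ℚ _ x)
  rw [CohomB.map_ι, CohomB.map_ι, CohomB.map_ι]
  congr 1
  induction x with
  | zero => simp
  | add x y hx hy => rw [map_add, map_add, map_add, hx, hy]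
  | tmul q χ => rfl

theorem CohomB.map_mem_degree {A : Type} [AddCommGroup A] {c a : A} (f : S →ₜ* T) {x : CohomB T}
    (hx : x ∈ CohomB.degree c a) : CohomB.map f x ∈ CohomB.degree c a := by
  have h : (CohomB.degree c a).map (CohomB.map f).toLinearMap ≤ CohomB.degree (T := S) c a := by
    unfold CohomB.degree
    rw [Submodule.map_iSup, iSup_le_iff]
    intro n
    refine le_iSup_of_le n ?_
    rw [Submodule.map_pow]
    refine pow_le_pow_left' ?_ _
    rintro _ ⟨_, ⟨y, rfl⟩, rfl⟩
    exact ⟨_, (CohomB.map_ι f y).symm⟩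
  exact h ⟨x, hx, rfl⟩

end Cohomology

section Subgroups
variable (G : Type) [CommGroup G] [TopologicalSpace G]

/-- The poset of connected closed subgroups of `G`, ordered by inclusion. -/
abbrev ConnSub : Type := {K : ClosedSubgroup G // IsConnected (K : Set G)}

variable {G}

/-- The closed subgroups of `G` with identity component `K`. -/
abbrev Mult (K : ConnSub G) : Type :=
  {K' : ClosedSubgroup G // connectedComponentIn (K' : Set G) 1 = (K.1 : Set G)}

/-- The underlying subgroup. -/
abbrev Mult.sub {K : ConnSub G} (K' : Mult K) : Subgroup G := K'.1.toSubgroup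

/-- The projection `G / N → G / N'` for `N ≤ N'`. -/
def quotMap {N N' : Subgroup G} (h : N ≤ N') : (G ⧸ N) →ₜ* (G ⧸ N') where
  toMonoidHom := QuotientGroup.map N N' (MonoidHom.id G) h
  continuous_toFun := by
    change Continuous (QuotientGroup.map N N' (MonoidHom.id G) h)
    exact Continuous.quotient_lift (QuotientGroup.continuous_mk) _

/-- The character of `G / N` given by a character of `G` that is trivial on `N`. -/
noncomputable def descend (χ : PontryaginDual G) (N : Subgroup G) (h : ∀ g ∈ N, χ g = 1) :
    PontryaginDual (G ⧸ N) :=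
  show (G ⧸ N) →ₜ* Circle from
  { toMonoidHom := QuotientGroup.lift N (show G →ₜ* Circle from χ).toMonoidHom h
    continuous_toFun := Continuous.quotient_lift (map_continuous (show G →ₜ* Circle from χ)) _ }

theorem component_le {K : ConnSub G} (K' : Mult K) : K.1.toSubgroup ≤ K'.sub := by
  intro x hx
  have : x ∈ connectedComponentIn (K'.1 : Set G) 1 := by rw [K'.2]; exact hx
  exact connectedComponentIn_subset _ _ this

variable [IsTopologicalGroup G] [CompactSpace G] [T2Space G]

/-- The map `L' ↦ L' K` from subgroups with identity component `L` to subgroups with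
identity component `K`, for `L ⊆ K`. -/
def push {L K : ConnSub G} (h : L ≤ K) (L' : Mult L) : Mult K :=
  ⟨⟨L'.sub ⊔ K.1.toSubgroup, isClosed_sup _ _ L'.1.isClosed' K.1.isClosed'⟩,
    component_sup _ _ L'.1.isClosed' K.1.isClosed' K.2 (L'.2.trans_subset h)⟩

theorem le_push {L K : ConnSub G} (h : L ≤ K) (L' : Mult L) : L'.sub ≤ (push h L').sub :=
  le_sup_left

theorem push_refl {K : ConnSub G} (K' : Mult K) : push le_rfl K' = K' := by
  apply Subtype.ext
  apply ClosedSubgroup.toSubgroup_injective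
  exact sup_eq_left.mpr (component_le K')

theorem push_push {M L K : ConnSub G} (h : M ≤ L) (h' : L ≤ K) (M' : Mult M) :
    push h' (push h M') = push (h.trans h') M' := by
  apply Subtype.ext
  apply ClosedSubgroup.toSubgroup_injective
  change (M'.sub ⊔ L.1.toSubgroup) ⊔ K.1.toSubgroup = M'.sub ⊔ K.1.toSubgroup
  rw [sup_assoc, sup_eq_right.mpr (show L.1.toSubgroup ≤ K.1.toSubgroup from h')]

/-- The product, over all closed subgroups `K'` with identity component `K`, of the rings
`H^*(B(G/K'); ℚ)`. -/
abbrev CohomProd (K : ConnSub G) : Type := ∀ K' : Mult K, CohomB (G ⧸ K'.sub)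

/-- Inflation, for `L ⊆ K`: the coordinate of `infl x` at `L'` is the inflation of the coordinate
of `x` at `L' K`. -/
noncomputable def infl {L K : ConnSub G} (h : L ≤ K) : CohomProd K →+* CohomProd L :=
  RingHom.pi fun L' => (CohomB.map (quotMap (le_push h L'))).toRingHom.comp
    (Pi.evalRingHom _ (push h L'))

theorem infl_apply {L K : ConnSub G} (h : L ≤ K) (x : CohomProd K) (L' : Mult L) :
    infl h x L' = CohomB.map (quotMap (le_push h L')) (x (push h L')) := rfl

theorem infl_refl {K : ConnSub G} : infl (le_refl K) = RingHom.id (CohomProd K) := by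
  refine RingHom.ext fun x => funext fun K' => ?_
  rw [infl_apply]
  have key : ∀ (K'' : Mult K) (e : K'' = K') (h : K'.sub ≤ K''.sub),
      CohomB.map (quotMap h) (x K'') = x K' := by
    rintro K'' rfl h
    have : quotMap h = ContinuousMonoidHom.id (G ⧸ K''.sub) := by
      ext y
      induction y using QuotientGroup.induction_on
      rfl
    rw [this, CohomB.map_id]
    rfl
  exact key _ (push_refl K') _

theorem infl_infl {M L K : ConnSub G} (h : M ≤ L) (h' : L ≤ K) :
    (infl h).comp (infl h') = infl (h.trans h') := by
  refine RingHom.ext fun x => funext fun M' => ?_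
  rw [RingHom.comp_apply, infl_apply, infl_apply, infl_apply]
  have key : ∀ (K' K'' : Mult K) (e : K' = K'') (L' : Mult L) (h1 : M'.sub ≤ L'.sub)
      (h2 : L'.sub ≤ K'.sub) (h3 : M'.sub ≤ K''.sub),
      CohomB.map (quotMap h1) (CohomB.map (quotMap h2) (x K')) = CohomB.map (quotMap h3) (x K'') := by
    rintro K' K'' rfl L' h1 h2 h3
    rw [← AlgHom.comp_apply, CohomB.map_comp]
    congr 2
    ext y
    induction y using QuotientGroup.induction_on
    rfl
  exact key _ _ (push_push h h' M') _ _ _ _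

open Classical in
/-- The Euler class of a character `χ` of `G` at `H`: its coordinate at `H'` is the Euler class
`c₁(χ^{H'})` of the `H'`-fixed points of `χ`, which is `c₁(χ)` if `χ` is trivial on `H'` and `1`
(the Euler class of the zero representation) otherwise. -/
noncomputable def euler (H : ConnSub G) (χ : PontryaginDual G) : CohomProd H := fun H' =>
  if h : ∀ g ∈ H'.sub, χ g = 1 then chern (descend χ H'.sub h) else 1

/-- `H` is maximal among the proper connected closed subgroups. -/
def IsMaxProper (H : ConnSub G) : Prop :=
  H.1.toSubgroup ≠ ⊤ ∧ ∀ K : ConnSub G, H < K → K.1.toSubgroup = ⊤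

/-- The multiplicative set `𝓔_{K/L}` generated by the inflations to `L` of the Euler classes of
nontrivial characters at the maximal subgroups `H` that contain `L` but not `K`. -/
noncomputable def eulerSet (K L : ConnSub G) : Submonoid (CohomProd L) :=
  Submonoid.closure {x | ∃ (H : ConnSub G) (hLH : L ≤ H) (χ : PontryaginDual G),
    IsMaxProper H ∧ ¬ K ≤ H ∧ χ ≠ 1 ∧ x = infl hLH (euler H χ)}

theorem eulerSet_le {H K L M : ConnSub G} (h : K ≤ H) (h' : M ≤ L) :
    eulerSet K L ≤ (eulerSet H M).comap (infl h') := by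
  unfold eulerSet
  rw [Submonoid.closure_le]
  rintro _ ⟨J, hLJ, χ, hJ, hKJ, hχ, rfl⟩
  refine Submonoid.subset_closure ⟨J, h'.trans hLJ, χ, hJ, fun hHJ => hKJ (h.trans hHJ), hχ, ?_⟩
  rw [← infl_infl h' hLJ]
  rfl

end Subgroups

section Pairs

/-- Pairs `fst ⊇ snd` in a poset. -/
@[ext]
structure QPair (P : Type) [PartialOrder P] where
  fst : P
  snd : P
  le : snd ≤ fst

/-- `(K ⊇ L) ≤ (H ⊇ M)` if `H ⊇ K ⊇ L ⊇ M`. -/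
instance (P : Type) [PartialOrder P] : PartialOrder (QPair P) where
  le p q := p.fst ≤ q.fst ∧ q.snd ≤ p.snd
  le_refl p := ⟨le_rfl, le_rfl⟩
  le_trans p q r h h' := ⟨h.1.trans h'.1, h'.2.trans h.2⟩
  le_antisymm p q h h' := QPair.ext (h.1.antisymm h'.1) (h'.2.antisymm h.2)

/-- Flags: nonempty finite chains, ordered by inclusion. -/
abbrev Flags (P : Type) [PartialOrder P] : Type := PartialOrder.NonemptyFiniteChains P

variable {P : Type} [PartialOrder P]

theorem Flags.exists_first (F : Flags P) : ∃ x, IsGreatest (F.finset : Set P) x := by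
  obtain ⟨x, hx⟩ := F.finset.exists_maximal F.nonempty
  refine ⟨x, hx.1, fun y hy => ?_⟩
  rcases F.comparable ⟨x, hx.1⟩ ⟨y, hy⟩ with h | h
  · exact hx.2 hy h
  · exact h

theorem Flags.exists_last (F : Flags P) : ∃ x, IsLeast (F.finset : Set P) x := by
  obtain ⟨x, hx⟩ := F.finset.exists_minimal F.nonempty
  refine ⟨x, hx.1, fun y hy => ?_⟩
  rcases F.comparable ⟨x, hx.1⟩ ⟨y, hy⟩ with h | h
  · exact h
  · exact hx.2 hy h

/-- The first, i.e. largest, element of a flag. -/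
noncomputable def Flags.first (F : Flags P) : P := F.exists_first.choose

/-- The last, i.e. smallest, element of a flag. -/
noncomputable def Flags.last (F : Flags P) : P := F.exists_last.choose

theorem Flags.first_spec (F : Flags P) : IsGreatest (F.finset : Set P) F.first :=
  F.exists_first.choose_spec

theorem Flags.last_spec (F : Flags P) : IsLeast (F.finset : Set P) F.last :=
  F.exists_last.choose_spec

/-- The flag with the single element `x`. -/
def Flags.singleton (x : P) : Flags P where
  finset := {x}
  comparable := by
    rintro ⟨a, ha⟩ ⟨b, hb⟩
    left
    simp only [Finset.mem_singleton] at ha hb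
    subst ha hb
    exact le_rfl

theorem Flags.singleton_first_le (F : Flags P) : Flags.singleton F.first ≤ F := by
  intro x hx
  rw [Finset.mem_singleton.mp hx]
  exact F.first_spec.1

/-- The pair (first element, last element) of a flag. -/
noncomputable def Flags.ends (F : Flags P) : QPair P :=
  ⟨F.first, F.last, F.first_spec.2 F.last_spec.1⟩

theorem Flags.ends_mono : Monotone (Flags.ends : Flags P → QPair P) := fun E F h =>
  ⟨F.first_spec.2 (h E.first_spec.1), F.last_spec.2 (h E.last_spec.1)⟩

end Pairs

section GradedModules

/-- A diagram of commutative rings graded by `A`, with the shape of a preorder `P`. (That the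
homogeneous parts are independent is not recorded; it holds for the diagrams used below.) -/
structure GradedRings (P : Type) [Preorder P] (A : Type) [AddCommGroup A] where
  /-- the rings -/
  ring : P ⥤ CommRingCat.{0}
  /-- their homogeneous parts -/
  deg (p : P) : A → AddSubgroup (ring.obj p)
  one_mem (p : P) : (1 : ring.obj p) ∈ deg p 0
  mul_mem (p : P) {a b : A} {x y : ring.obj p} : x ∈ deg p a → y ∈ deg p b → x * y ∈ deg p (a + b)
  iSup_deg (p : P) : ⨆ a, deg p a = ⊤
  map_mem {p q : P} (f : p ⟶ q) {a : A} {x : ring.obj p} :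
    x ∈ deg p a → (ring.map f).hom x ∈ deg q a

variable {P : Type} [Preorder P] {A : Type} [AddCommGroup A]

/-- Restriction of a diagram of graded rings along a monotone map. -/
def GradedRings.pullback {Q : Type} [Preorder Q] (S : GradedRings P A) {f : Q → P}
    (hf : Monotone f) : GradedRings Q A where
  ring := hf.functor ⋙ S.ring
  deg q := S.deg (f q)
  one_mem q := S.one_mem (f q)
  mul_mem q := S.mul_mem (f q)
  iSup_deg q := S.iSup_deg (f q)
  map_mem g := S.map_mem (hf.functor.map g)

/-- A diagram of shape `P`, as a presheaf on the opposite category. -/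
abbrev GradedRings.presheaf (S : GradedRings P A) : Pᵒᵖᵒᵖ ⥤ RingCat.{0} :=
  (unopUnop P ⋙ S.ring) ⋙ forget₂ CommRingCat RingCat

/-- The structure maps of a diagram of modules. -/
abbrev step {p q : P} (h : p ≤ q) : op (op p) ⟶ op (op q) := (homOfLE h).op.op

/-- Graded modules over a diagram of graded rings. For trivial `A` these are all modules over the
diagram of rings; for `A = ℤ` they are graded modules in the usual sense. -/
structure GrMod (S : GradedRings P A) where
  /-- the underlying diagram of modules -/
  mod : PresheafOfModules.{0} S.presheaf
  /-- the homogeneous parts -/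
  gr (p : P) : A → AddSubgroup (mod.obj (op (op p)))
  isInternal [DecidableEq A] (p : P) : DirectSum.IsInternal (gr p)
  smul_mem (p : P) {a b : A} {x : S.ring.obj p} {m : mod.obj (op (op p))} :
    x ∈ S.deg p a → m ∈ gr p b → x • m ∈ gr p (a + b)
  map_mem {p q : P} (h : p ≤ q) {a : A} {m : mod.obj (op (op p))} :
    m ∈ gr p a → (mod.map (step h)).hom m ∈ gr q a

variable {S : GradedRings P A}

/-- Maps of graded modules: maps of diagrams of modules that preserve degrees. -/
@[ext]
structure GrMod.Hom (M N : GrMod S) where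
  /-- the underlying map -/
  hom : M.mod ⟶ N.mod
  map_mem (p : P) {a : A} {m : M.mod.obj (op (op p))} :
    m ∈ M.gr p a → (hom.app (op (op p))).hom m ∈ N.gr p a

instance : Category (GrMod S) where
  Hom := GrMod.Hom
  id M := ⟨𝟙 M.mod, fun _ _ _ h => h⟩
  comp f g := ⟨f.hom ≫ g.hom, fun p _ _ h => g.map_mem p (f.map_mem p h)⟩

/-- The structure map `M(p) → M(q)` is an extension of scalars: the induced map
`S(q) ⊗_{S(p)} M(p) → M(q)` is an isomorphism. -/
def GrMod.IsExtension (M : GrMod S) {p q : P} (h : p ≤ q) : Prop :=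
  IsIso (((ModuleCat.extendRestrictScalarsAdj (S.ring.map (homOfLE h)).hom).homEquiv
    (M.mod.obj (op (op p))) (M.mod.obj (op (op q)))).symm (M.mod.map (step h)))

end GradedModules

section TorusDiagrams
variable (G : Type) [CommGroup G] [TopologicalSpace G] [IsTopologicalGroup G] [CompactSpace G]
  [T2Space G] {A : Type} [AddCommGroup A] (c : A)

/-- The localization `𝓔_{K/L}⁻¹ ∏ H^*(B(G/L'); ℚ)` at the pair `K ⊇ L`. -/
abbrev Loc {G : Type} [CommGroup G] [TopologicalSpace G] [IsTopologicalGroup G] [CompactSpace G]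
    [T2Space G] (p : QPair (ConnSub G)) : Type :=
  Localization (eulerSet p.fst p.snd)

variable {G}

/-- The elements of degree `a` of the localization at a pair: fractions `x / s` such that in every
coordinate `s` is homogeneous and the degree of `x` exceeds that of `s` by `a`. -/
noncomputable def Loc.degree (p : QPair (ConnSub G)) (a : A) : AddSubgroup (Loc p) where
  carrier := {z | ∃ (x : CohomProd p.snd) (s : eulerSet p.fst p.snd), z = Localization.mk x s ∧
    ∀ L', ∃ b, s.1 L' ∈ CohomB.degree c b ∧ x L' ∈ CohomB.degree c (a + b)}
  zero_mem' := ⟨0, 1, (Localization.mk_zero _).symm, fun L' =>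
    ⟨0, CohomB.one_mem_degree c, Submodule.zero_mem _⟩⟩
  add_mem' := by
    rintro _ _ ⟨x, s, rfl, hx⟩ ⟨y, t, rfl, hy⟩
    refine ⟨_, _, Localization.add_mk _ _ _ _, fun L' => ?_⟩
    obtain ⟨b, hs, hxb⟩ := hx L'
    obtain ⟨b', ht, hyb⟩ := hy L'
    refine ⟨b + b', CohomB.mul_mem_degree hs ht, Submodule.add_mem _ ?_ ?_⟩
    · have := CohomB.mul_mem_degree hs hyb
      rwa [show b + (a + b') = a + (b + b') by abel] at this
    · have := CohomB.mul_mem_degree ht hxb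
      rwa [show b' + (a + b) = a + (b + b') by abel] at this
  neg_mem' := by
    rintro _ ⟨x, s, rfl, hx⟩
    refine ⟨-x, s, Localization.neg_mk _ _, fun L' => ?_⟩
    obtain ⟨b, hs, hxb⟩ := hx L'
    exact ⟨b, hs, Submodule.neg_mem _ hxb⟩

theorem Loc.one_mem_degree (p : QPair (ConnSub G)) : (1 : Loc p) ∈ Loc.degree c p 0 :=
  ⟨1, 1, Localization.mk_one.symm, fun _ => ⟨0, CohomB.one_mem_degree c, by
    rw [add_zero]; exact CohomB.one_mem_degree c⟩⟩

variable {c}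

theorem Loc.mul_mem_degree {p : QPair (ConnSub G)} {a a' : A} {z w : Loc p}
    (hz : z ∈ Loc.degree c p a) (hw : w ∈ Loc.degree c p a') : z * w ∈ Loc.degree c p (a + a') := by
  obtain ⟨x, s, rfl, hx⟩ := hz
  obtain ⟨y, t, rfl, hy⟩ := hw
  refine ⟨_, _, Localization.mk_mul _ _ _ _, fun L' => ?_⟩
  obtain ⟨b, hs, hxb⟩ := hx L'
  obtain ⟨b', ht, hyb⟩ := hy L'
  refine ⟨b + b', CohomB.mul_mem_degree hs ht, ?_⟩
  have := CohomB.mul_mem_degree hxb hyb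
  rwa [show (a + b) + (a' + b') = (a + a') + (b + b') by abel] at this

/-- The map of localizations induced by inflation. -/
noncomputable def Loc.map {p q : QPair (ConnSub G)} (h : p ≤ q) : Loc p →+* Loc q :=
  IsLocalization.map _ (infl h.2) (eulerSet_le h.1 h.2)

theorem Loc.map_mem_degree {p q : QPair (ConnSub G)} (h : p ≤ q) {a : A} {z : Loc p}
    (hz : z ∈ Loc.degree c p a) : Loc.map h z ∈ Loc.degree c q a := by
  obtain ⟨x, s, rfl, hx⟩ := hz
  refine ⟨infl h.2 x, ⟨infl h.2 s.1, eulerSet_le h.1 h.2 s.2⟩, ?_, fun L' => ?_⟩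
  · rw [Loc.map, Localization.mk_eq_mk', IsLocalization.map_mk', Localization.mk_eq_mk']
  · obtain ⟨b, hs, hxb⟩ := hx (push h.2 L')
    exact ⟨b, CohomB.map_mem_degree _ hs, CohomB.map_mem_degree _ hxb⟩

variable (c)

/-- The ring `R(K ⊇ L)`: the sums of homogeneous elements of the localization. -/
noncomputable def pairRing (p : QPair (ConnSub G)) : Subring (Loc p) where
  __ := ⨆ a, Loc.degree c p a
  one_mem' := AddSubgroup.mem_iSup_of_mem 0 (Loc.one_mem_degree c p)
  mul_mem' := by
    intro z w hz hw
    change z ∈ ⨆ a, Loc.degree c p a at hz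
    change w ∈ ⨆ a, Loc.degree c p a at hw
    change z * w ∈ ⨆ a, Loc.degree c p a
    induction hz using AddSubgroup.iSup_induction' with
    | hp a z hz =>
      induction hw using AddSubgroup.iSup_induction' with
      | hp b w hw => exact AddSubgroup.mem_iSup_of_mem _ (Loc.mul_mem_degree hz hw)
      | h1 => rw [mul_zero]; exact AddSubgroup.zero_mem _
      | hadd w w' _ _ h h' => rw [mul_add]; exact AddSubgroup.add_mem _ h h'
    | h1 => rw [zero_mul]; exact AddSubgroup.zero_mem _
    | hadd z z' _ _ h h' => rw [add_mul]; exact AddSubgroup.add_mem _ h h'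

theorem pairRing_map {p q : QPair (ConnSub G)} (h : p ≤ q) (z : Loc p) (hz : z ∈ pairRing c p) :
    Loc.map h z ∈ pairRing c q := by
  change z ∈ ⨆ a, Loc.degree c p a at hz
  change Loc.map h z ∈ ⨆ a, Loc.degree c q a
  induction hz using AddSubgroup.iSup_induction' with
  | hp a z hz => exact AddSubgroup.mem_iSup_of_mem a (Loc.map_mem_degree h hz)
  | h1 => rw [map_zero]; exact AddSubgroup.zero_mem _
  | hadd z z' _ _ h h' => rw [map_add]; exact AddSubgroup.add_mem _ h h'

theorem pairRing_iSup (p : QPair (ConnSub G)) :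
    ⨆ a, (Loc.degree c p a).comap (pairRing c p).subtype.toAddMonoidHom = ⊤ := by
  rw [eq_top_iff]
  rintro ⟨z, hz⟩ -
  change z ∈ ⨆ a, Loc.degree c p a at hz
  induction hz using AddSubgroup.iSup_induction' with
  | hp a z hz => exact AddSubgroup.mem_iSup_of_mem a hz
  | h1 => exact AddSubgroup.zero_mem _
  | hadd z z' _ _ h h' => exact AddSubgroup.add_mem _ h h'

variable (G)

/-- The diagram of graded rings `R_c^p` on pairs of connected subgroups. -/
noncomputable def Rcp : GradedRings (QPair (ConnSub G)) A where
  ring :=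
    { obj := fun p => CommRingCat.of (pairRing c p)
      map := fun {p q} f => CommRingCat.ofHom
        ((Loc.map (leOfHom f)).restrict (pairRing c p) (pairRing c q) (pairRing_map c (leOfHom f)))
      map_id := fun p => by
        ext ⟨z, hz⟩
        change Loc.map (le_refl p) z = z
        unfold Loc.map
        simp only [infl_refl]
        exact IsLocalization.map_id z _
      map_comp := fun {p q r} f g => by
        ext ⟨z, hz⟩
        change Loc.map ((leOfHom f).trans (leOfHom g)) z =
          Loc.map (leOfHom g) (Loc.map (leOfHom f) z)
        unfold Loc.map
        rw [IsLocalization.map_map]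
        simp only [infl_infl] }
  deg p a := (Loc.degree c p a).comap (pairRing c p).subtype.toAddMonoidHom
  one_mem p := Loc.one_mem_degree c p
  mul_mem p _ _ _ _ hx hy := Loc.mul_mem_degree hx hy
  iSup_deg p := pairRing_iSup c p
  map_mem f _ _ hx := Loc.map_mem_degree (leOfHom f) hx

/-- The diagram of graded rings `R_c^f` on flags of connected subgroups: the value at
`H₀ ⊃ ⋯ ⊃ Hₛ` is the localization at `𝓔_{H₀/Hₛ}` of the product for `Hₛ`. -/
noncomputable def Rcf : GradedRings (Flags (ConnSub G)) A :=
  (Rcp G c).pullback Flags.ends_mono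

/-- Extended `R_c^p`-modules: the vertical maps `(H ⊇ K) → (H ⊇ L)` are extensions of scalars. -/
def eP : ObjectProperty (GrMod (Rcp G c)) := fun M =>
  ∀ (p q : QPair (ConnSub G)) (h : p ≤ q), p.fst = q.fst → M.IsExtension h

/-- Quasi-coherent `R_c^p`-modules: the horizontal maps `(K ⊇ L) → (H ⊇ L)` are extensions of
scalars. -/
def qcP : ObjectProperty (GrMod (Rcp G c)) := fun M =>
  ∀ (p q : QPair (ConnSub G)) (h : p ≤ q), p.snd = q.snd → M.IsExtension h

/-- Quasi-coherent extended `R_c^p`-modules. -/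
def qceP : ObjectProperty (GrMod (Rcp G c)) := qcP G c ⊓ eP G c

theorem qceP_le_eP : qceP G c ≤ eP G c := fun _ h => h.2

/-- Extended `R_c^f`-modules: the value at a flag is the extension of scalars of the value at its
first element. -/
def eF : ObjectProperty (GrMod (Rcf G c)) := fun M =>
  ∀ F : Flags (ConnSub G), M.IsExtension F.singleton_first_le

/-- Quasi-coherent extended `R_c^f`-modules: all structure maps are extensions of scalars. -/
def qceF : ObjectProperty (GrMod (Rcf G c)) := fun M =>
  ∀ (E F : Flags (ConnSub G)) (h : E ≤ F), M.IsExtension h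

theorem qceF_le_eF : qceF G c ≤ eF G c := fun _ h F => h _ F _

end TorusDiagrams

end TorusModel

open TorusModel

/-! ### Extension of scalars in terms of elements -/

section BaseExtension
variable {R R' : Type} [CommRing R] [CommRing R'] {f : R →+* R'}
  {M M' : Type} [AddCommGroup M] [Module R M] [AddCommGroup M'] [Module R' M']

/-! All the inclusions are cases of one statement. Take any diagram `S` of graded rings on a
preorder and any class `W` of its structure maps. The graded modules whose structure maps in `W` are
extensions of scalars form a coreflective full subcategory (`GrMod.isLeftAdjoint_extOn_ι`). The four
properties `e` and `qce`, for pairs and for flags, are four choices of `W`, and the functor from `e`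
to `qce` is the restriction of the coreflection for `qce`. Only right exactness of extension of
scalars is used, never flatness.

The class has a set of generators (`GrDiag.exists_generators`). Start from an element of a module in
the class, and close up under linear combinations, structure maps, homogeneous components, finite
lists of generators along `W`, and finite lists of elements that force the relations holding along
`W`. The result is a graded submodule in the class (`IsExtOn.exists_small`). Finite lists suffice
because a tensor that vanishes already vanishes over a finitely generated submodule
(`IsBaseExt.exists_list`). Every element of the result is named by an expression from the fixed type
`Term S`, so up to isomorphism only a set of modules arises.

The coreflection of `M` is then a quotient (`GrDiag.exists_coreflection`). Let `Z` be the sum of the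
generators over all their maps to `M`, with induced map `φ : Z → M`. Call a graded submodule
generated if along `W` its value at the target is spanned by the image of its value at the source
(`Sub.IsGen`). Sums of generated submodules are generated, so there is a largest one `K` inside the
kernel of `φ`, and `Z/K` is again in the class. For `X` in the class and `f : X → M`, a sum of
generators covers `X`; the kernel of this cover is generated (`Sub.isGen_ker`), hence is sent into
`K`, and `f` lifts to `Z/K`. The difference of two lifts has generated image, whose preimage in `Z`
is generated and killed by `φ` (`Sub.IsGen.comap_toQuot`), so it lies in `K` and the lifts agree. -/

/-- The semilinear map `t` exhibits `M'` as the extension of scalars of `M` along `f`. -/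
structure IsBaseExt (t : M →ₛₗ[f] M') : Prop where
  span_eq_top : Submodule.span R' (Set.range t) = ⊤
  exists_lift : ∀ (N : Type) [AddCommGroup N] [Module R' N] (g : M →ₛₗ[f] N),
    ∃ g' : M' →ₗ[R'] N, ∀ x, g' (t x) = g x

theorem IsBaseExt.hom_ext {t : M →ₛₗ[f] M'} (h : IsBaseExt t) {N : Type} [AddCommGroup N]
    [Module R' N] {u v : M' →ₗ[R'] N} (huv : ∀ x, u (t x) = v (t x)) : u = v :=
  LinearMap.ext_on_range h.span_eq_top huv

/-- A Yoneda argument: maps `Y ⟶ N` precomposed with the transpose `φ` correspond to semilinear maps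
out of `X` factoring through `t`. Spanning gives uniqueness of the factorization and `exists_lift`
gives existence. -/
theorem isIso_homEquiv_symm_iff {X : ModuleCat.{0} R} {Y : ModuleCat.{0} R'}
    (g : X ⟶ (ModuleCat.restrictScalars f).obj Y) (t : X →ₛₗ[f] Y) (hg : ∀ x, g.hom x = t x) :
    IsIso (((ModuleCat.extendRestrictScalarsAdj f).homEquiv X Y).symm g) ↔ IsBaseExt t := by
  set adj := ModuleCat.extendRestrictScalarsAdj f
  set φ := (adj.homEquiv X Y).symm g with hφ
  have hφ' : adj.homEquiv X Y φ = g := by simp [φ]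
  have key : ∀ {N : ModuleCat.{0} R'} (u v : Y ⟶ N), (∀ x, u.hom (t x) = v.hom (t x)) →
      φ ≫ u = φ ≫ v := by
    intro N u v huv
    apply (adj.homEquiv X N).injective
    rw [adj.homEquiv_naturality_right, adj.homEquiv_naturality_right, hφ']
    ext x
    have := huv x
    rw [← hg] at this
    exact this
  have hstep : ∀ {N : ModuleCat.{0} R'} (u : Y ⟶ N) (x : X),
      (adj.homEquiv X N (φ ≫ u)).hom x = u.hom (t x) := by
    intro N u x
    rw [adj.homEquiv_naturality_right, hφ', ← hg]
    rfl
  constructor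
  · intro h
    constructor
    -- The projection of `Y` onto its quotient by the span kills the image of `t`, hence vanishes
    -- because `φ` is epi.
    · have : (ModuleCat.ofHom (Submodule.mkQ (Submodule.span R' (Set.range t))) :
          Y ⟶ ModuleCat.of R' _) = 0 := by
        rw [← cancel_epi φ]
        refine key _ _ fun x => ?_
        exact (Submodule.Quotient.mk_eq_zero _).mpr (Submodule.subset_span ⟨x, rfl⟩)
      have h2 := congrArg ModuleCat.Hom.hom this
      rw [eq_top_iff]
      intro y _
      rw [← Submodule.Quotient.mk_eq_zero]
      exact LinearMap.congr_fun h2 y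
    · intro N _ _ k
      let k' : X ⟶ (ModuleCat.restrictScalars f).obj (ModuleCat.of R' N) :=
        ModuleCat.ofHom (Y := (ModuleCat.restrictScalars f).obj (ModuleCat.of R' N))
          { toFun := k, map_add' := map_add k, map_smul' := fun r x => map_smulₛₗ k r x }
      refine ⟨(inv φ ≫ (adj.homEquiv X (ModuleCat.of R' N)).symm k').hom, fun x => ?_⟩
      rw [← hstep, IsIso.hom_inv_id_assoc, Equiv.apply_symm_apply]
      rfl
  · intro h
    have lift : ∀ (N : ModuleCat.{0} R') (j : X ⟶ (ModuleCat.restrictScalars f).obj N),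
        ∃ k : Y ⟶ N, ∀ x, k.hom (t x) = j.hom x := by
      intro N j
      obtain ⟨k, hk⟩ := h.exists_lift N
        { toFun := j.hom, map_add' := map_add j.hom, map_smul' := fun r x => map_smul j.hom r x }
      exact ⟨ModuleCat.ofHom k, hk⟩
    obtain ⟨k, hk⟩ := lift _ (adj.homEquiv X _ (𝟙 _))
    have h1 : φ ≫ k = 𝟙 _ := by
      apply (adj.homEquiv X _).injective
      ext x
      rw [hstep]
      exact hk x
    refine ⟨⟨k, h1, ?_⟩⟩
    apply ModuleCat.hom_ext
    refine h.hom_ext fun x => ?_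
    rw [← hstep, ← Category.assoc, h1, Category.id_comp, hφ', hg]
    rfl

/-- `M'` is a quotient of the free `R'`-module on the set `M`. A semilinear map extends to that free
module, and descends to `M'` as soon as it respects every relation among the `t x`. -/
theorem IsBaseExt.of_relations {t : M →ₛₗ[f] M'} (hs : Submodule.span R' (Set.range t) = ⊤)
    (hr : ∀ (n : ℕ) (r : Fin n → R') (x : Fin n → M), ∑ i, r i • t (x i) = 0 →
      ∀ (N : Type) [AddCommGroup N] [Module R' N] (g : M →ₛₗ[f] N), ∑ i, r i • g (x i) = 0) :
    IsBaseExt t := by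
  refine ⟨hs, fun N _ _ g => ?_⟩
  let T : (M →₀ R') →ₗ[R'] M' := Finsupp.linearCombination R' t
  let U : (M →₀ R') →ₗ[R'] N := Finsupp.linearCombination R' g
  have hT : Function.Surjective T := by
    rw [← LinearMap.range_eq_top, Finsupp.range_linearCombination, hs]
  have hker : LinearMap.ker T ≤ LinearMap.ker U := by
    intro z hz
    rw [LinearMap.mem_ker] at hz ⊢
    let e := z.support.equivFin
    have conv : ∀ (K : Type) [AddCommGroup K] [Module R' K] (u : M → K),
        Finsupp.linearCombination R' u z =
          ∑ i, z (e.symm i : M) • u (e.symm i) := by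
      intro K _ _ u
      rw [Finsupp.linearCombination_apply, Finsupp.sum, ← Finset.sum_coe_sort]
      exact (e.symm.sum_comp (fun i : z.support => z i • u i)).symm
    change Finsupp.linearCombination R' t z = 0 at hz
    change Finsupp.linearCombination R' g z = 0
    rw [conv] at hz ⊢
    exact hr _ _ _ hz N g
  refine ⟨(LinearMap.ker T).liftQ U hker ∘ₗ (T.quotKerEquivOfSurjective hT).symm, fun x => ?_⟩
  have : t x = T (Finsupp.single x 1) := by simp [T]
  rw [LinearMap.comp_apply, this]
  have h2 : (T.quotKerEquivOfSurjective hT).symm (T (Finsupp.single x 1)) =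
      Submodule.Quotient.mk (Finsupp.single x 1) := by
    rw [LinearEquiv.symm_apply_eq]; rfl
  erw [h2]
  simp [U]

/-- A relation in an extension of scalars is already a consequence of finitely many elements. -/
theorem IsBaseExt.exists_list {t : M →ₛₗ[f] M'} (h : IsBaseExt t) {n : ℕ} (r : Fin n → R')
    (x : Fin n → M) (hx : ∑ i, r i • t (x i) = 0) :
    ∃ L : List M, ∀ V : Submodule R M, (∀ y ∈ L, y ∈ V) → ∀ hV : ∀ i, x i ∈ V,
      ∀ (N : Type) [AddCommGroup N] [Module R' N] (g : V →ₛₗ[f] N),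
        ∑ i, r i • g ⟨x i, hV i⟩ = 0 := by
  let _ : Algebra R R' := f.toAlgebra
  let e : M →ₛₗ[f] R' ⊗[R] M :=
    { toFun := fun m => 1 ⊗ₜ m
      map_add' := fun a b => TensorProduct.tmul_add _ _ _
      map_smul' := fun a b => by
        rw [TensorProduct.tmul_smul, ← IsScalarTower.algebraMap_smul R' a]
        rfl }
  -- The lift of `m ↦ 1 ⊗ m` carries the relation in `M'` to one in `R' ⊗ M`.
  obtain ⟨e', he'⟩ := h.exists_lift _ e
  have h0 : ∑ i, r i ⊗ₜ[R] x i = 0 := by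
    have := congrArg e' hx
    rw [map_sum, map_zero] at this
    rw [← this]
    refine Finset.sum_congr rfl fun i _ => ?_
    rw [map_smul, he']
    change _ = r i • ((1 : R') ⊗ₜ[R] x i)
    rw [TensorProduct.smul_tmul', smul_eq_mul, mul_one]
  let P : Submodule R M := Submodule.span R (Set.range x)
  have hP : P.FG := Submodule.fg_span (Set.finite_range x)
  let z : P ⊗[R] R' := ∑ i, (⟨x i, Submodule.subset_span ⟨i, rfl⟩⟩ : P) ⊗ₜ r i
  have hz : LinearMap.rTensor R' P.subtype z = 0 := by
    have := congrArg (TensorProduct.comm R R' M) h0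
    simp only [map_sum, TensorProduct.comm_tmul, map_zero] at this
    simpa [z] using this
  -- The tensor vanishes over `M`, hence already over some finitely generated `Q ⊇ P`; generators of
  -- `Q` form the required list.
  obtain ⟨Q, hPQ, hQ, hz'⟩ := TensorProduct.eq_zero_of_fg_of_subtype_eq_zero hP hz
  obtain ⟨s, hs⟩ := hQ
  refine ⟨s.toList, fun V hL hV N _ _ g => ?_⟩
  have hQV : Q ≤ V := by
    rw [← hs, Submodule.span_le]
    intro y hy
    exact hL y (Finset.mem_toList.mpr hy)
  let _ : Module R N := Module.compHom N f
  have : IsScalarTower R R' N := ⟨fun a b c => by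
    change (f a * b) • c = f a • b • c
    rw [mul_smul]⟩
  let g' : V →ₗ[R] N :=
    { toFun := g, map_add' := map_add g, map_smul' := fun a b => map_smulₛₗ g a b }
  -- Since `V` contains `Q`, the map `g` induces a map on `Q ⊗ R'`, which transports the vanishing
  -- to `N`.
  let k : Q ⊗[R] R' →ₗ[R] N := TensorProduct.lift
    (LinearMap.mk₂ R (fun (q : Q) (a : R') => a • g' (Submodule.inclusion hQV q))
      (fun a b c => by rw [map_add, map_add, smul_add])
      (fun a b c => by rw [map_smul, map_smul, smul_comm])
      (fun a b c => by rw [add_smul])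
      (fun a b c => by rw [smul_assoc]))
  have := congrArg k hz'
  simp only [z, map_sum, map_zero, LinearMap.rTensor_tmul] at this
  exact this

end BaseExtension

/-! ### Graded modules over a diagram, in terms of elements -/

section Diagrams
section Internal
variable {A : Type}

/-- The maps `c b` read off the components of any sum of homogeneous elements, so the decomposition
is unique. Together with `DirectSum.IsInternal.exists_proj` this trades internal direct sums for
families of projections, which pass easily to submodules, quotients and sums. -/
theorem DirectSum.isInternal_of_proj {X : Type} [AddCommGroup X] [DecidableEq A]
    (gr : A → AddSubgroup X) (h : ⨆ a, gr a = ⊤) (c : A → X →+ X)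
    (h1 : ∀ a, ∀ x ∈ gr a, c a x = x) (h2 : ∀ a b, a ≠ b → ∀ x ∈ gr a, c b x = 0) :
    DirectSum.IsInternal gr := by
  have key : ∀ (z : DirectSum A fun a => gr a) (b : A),
      c b (DirectSum.coeAddMonoidHom gr z) = z b := by
    intro z b
    induction z using DirectSum.induction_on with
    | zero => simp
    | of a x =>
      rw [DirectSum.coeAddMonoidHom_of]
      by_cases hab : a = b
      · subst hab
        rw [h1 a x x.2, DirectSum.of_eq_same]
      · rw [h2 a b hab x x.2, DirectSum.of_eq_of_ne _ _ _ (Ne.symm hab)]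
        rfl
    | add x y hx hy => rw [map_add, map_add, hx, hy]; rfl
  constructor
  · intro z w hzw
    refine DFinsupp.ext fun b => Subtype.ext ?_
    have h3 := key z b
    have h4 := key w b
    change DirectSum.coeAddMonoidHom gr z = DirectSum.coeAddMonoidHom gr w at hzw
    rw [hzw] at h3
    exact h3.symm.trans h4
  · have : (⊤ : AddSubgroup X) ≤ (DirectSum.coeAddMonoidHom gr).range := by
      rw [← h, iSup_le_iff]
      intro a x hx
      exact ⟨DirectSum.of (fun a => gr a) a ⟨x, hx⟩, DirectSum.coeAddMonoidHom_of _ _ _⟩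
    intro x
    exact this (AddSubgroup.mem_top x)

theorem DirectSum.IsInternal.exists_proj {X : Type} [AddCommGroup X] [DecidableEq A]
    {gr : A → AddSubgroup X} (h : DirectSum.IsInternal gr) :
    (⨆ a, gr a = ⊤) ∧ ∃ c : A → X →+ X, (∀ a, ∀ x ∈ gr a, c a x = x) ∧
      ∀ a b, a ≠ b → ∀ x ∈ gr a, c b x = 0 := by
  let e : (DirectSum A fun a => gr a) ≃+ X := AddEquiv.ofBijective _ h
  have he : ∀ a (x : gr a), e.symm x = DirectSum.of (fun a => gr a) a x := by
    intro a x
    rw [AddEquiv.symm_apply_eq]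
    exact (DirectSum.coeAddMonoidHom_of _ _ _).symm
  refine ⟨?_, fun b => ((gr b).subtype.comp (DFinsupp.evalAddMonoidHom b)).comp
    e.symm.toAddMonoidHom, ?_, ?_⟩
  · rw [eq_top_iff]
    intro x _
    obtain ⟨z, rfl⟩ := h.2 x
    induction z using DirectSum.induction_on with
    | zero => rw [map_zero]; exact AddSubgroup.zero_mem _
    | of a x =>
      rw [DirectSum.coeAddMonoidHom_of]
      exact AddSubgroup.mem_iSup_of_mem a x.2
    | add x y hx hy =>
      rw [map_add]
      exact AddSubgroup.add_mem _ (hx trivial) (hy trivial)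
  · intro a x hx
    change ((e.symm x) a : X) = x
    rw [he a ⟨x, hx⟩, DirectSum.of_eq_same]
  · intro a b hab x hx
    change ((e.symm x) b : X) = 0
    rw [he a ⟨x, hx⟩, DirectSum.of_eq_of_ne _ _ _ (Ne.symm hab)]
    rfl

end Internal

variable {P : Type} [Preorder P] {A : Type} [AddCommGroup A]

/-- The structure maps of a diagram of rings. -/
abbrev TorusModel.GradedRings.tr (S : GradedRings P A) {p q : P} (h : p ≤ q) :
    S.ring.obj p →+* S.ring.obj q := (S.ring.map (homOfLE h)).hom

/-- Graded modules over a diagram of graded rings, in terms of elements. -/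
structure GrDiag (S : GradedRings P A) where
  X : P → Type
  [addCommGroup : ∀ p, AddCommGroup (X p)]
  [module : ∀ p, Module (S.ring.obj p) (X p)]
  tr : ∀ {p q : P} (h : p ≤ q), X p →ₛₗ[S.tr h] X q
  tr_refl : ∀ {p : P} (h : p ≤ p) (x : X p), tr h x = x
  tr_tr : ∀ {p q r : P} (h : p ≤ q) (h' : q ≤ r) (x : X p), tr h' (tr h x) = tr (h.trans h') x
  gr : ∀ p, A → AddSubgroup (X p)
  iSup_gr : ∀ p, ⨆ a, gr p a = ⊤
  exists_proj : ∀ p, ∃ c : A → X p →+ X p, (∀ a, ∀ x ∈ gr p a, c a x = x) ∧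
    ∀ a b, a ≠ b → ∀ x ∈ gr p a, c b x = 0
  smul_mem : ∀ (p : P) {a b : A} {x : S.ring.obj p} {m : X p},
    x ∈ S.deg p a → m ∈ gr p b → x • m ∈ gr p (a + b)
  tr_mem : ∀ {p q : P} (h : p ≤ q) {a : A} {m : X p}, m ∈ gr p a → tr h m ∈ gr q a

attribute [instance] GrDiag.addCommGroup GrDiag.module

variable {S : GradedRings P A}

namespace GrDiag

/-- Maps of graded modules. -/
@[ext]
structure Hom (M N : GrDiag S) where
  app : ∀ p, M.X p →ₗ[S.ring.obj p] N.X p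
  app_tr : ∀ {p q : P} (h : p ≤ q) (x : M.X p), app q (M.tr h x) = N.tr h (app p x)
  app_mem : ∀ (p : P) {a : A} {x : M.X p}, x ∈ M.gr p a → app p x ∈ N.gr p a

/-- Composition of maps. -/
def Hom.comp {M N K : GrDiag S} (g : Hom N K) (f : Hom M N) : Hom M K where
  app p := g.app p ∘ₗ f.app p
  app_tr h x := by simp [f.app_tr, g.app_tr]
  app_mem p _ _ hx := g.app_mem p (f.app_mem p hx)

/-- The bundled form of a graded module. -/
noncomputable def toGrMod (M : GrDiag S) : GrMod S where
  mod :=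
    { obj := fun p => ModuleCat.of (S.ring.obj p.unop.unop) (M.X p.unop.unop)
      map := fun {p q} f => ModuleCat.ofHom
        (Y := (ModuleCat.restrictScalars (S.presheaf.map f).hom).obj
          (ModuleCat.of (S.ring.obj q.unop.unop) (M.X q.unop.unop)))
        { toFun := fun x => M.tr (leOfHom f.unop.unop) x
          map_add' := fun x y => map_add _ x y
          map_smul' := fun r x => map_smulₛₗ (M.tr (leOfHom f.unop.unop)) r x }
      map_id := fun p => by
        ext x
        exact M.tr_refl _ x
      map_comp := fun f g => by
        ext x
        exact (M.tr_tr _ _ x).symm }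
  gr p := M.gr p
  isInternal p := by
    obtain ⟨c, h1, h2⟩ := M.exists_proj p
    exact DirectSum.isInternal_of_proj _ (M.iSup_gr p) c h1 h2
  smul_mem p _ _ _ _ hx hm := M.smul_mem p hx hm
  map_mem h _ _ hm := M.tr_mem h hm

end GrDiag

open Classical in
/-- The elementwise form of a graded module. -/
noncomputable def TorusModel.GrMod.diag (M : GrMod S) : GrDiag S where
  X p := M.mod.obj (op (op p))
  addCommGroup p := inferInstance
  module p := inferInstanceAs (Module (S.presheaf.obj (op (op p))) (M.mod.obj (op (op p))))
  tr h :=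
    { toFun := fun x => (M.mod.map (step h)).hom x
      map_add' := fun x y => map_add (M.mod.map (step h)).hom x y
      map_smul' := fun r x => map_smul (M.mod.map (step h)).hom r x }
  tr_refl {p} h x := by
    have := M.mod.map_id (op (op p))
    exact congrArg (fun k => k.hom x) this
  tr_tr h h' x := (M.mod.map_comp_apply (step h) (step h') x).symm
  gr := M.gr
  iSup_gr p := (M.isInternal p).exists_proj.1
  exists_proj p := (M.isInternal p).exists_proj.2
  smul_mem p _ _ _ _ := M.smul_mem p
  tr_mem h _ _ := M.map_mem h

theorem TorusModel.GrMod.isExtension_iff (M : GrMod S) {p q : P} (h : p ≤ q) :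
    M.IsExtension h ↔ IsBaseExt (M.diag.tr h) :=
  isIso_homEquiv_symm_iff _ (M.diag.tr h) fun _ => rfl

/-- Maps of graded modules, in terms of elements. -/
noncomputable def TorusModel.GrMod.homEquivDiag (M N : GrMod S) :
    (M ⟶ N) ≃ GrDiag.Hom M.diag N.diag where
  toFun f :=
    { app := fun p => (f.hom.app (op (op p))).hom
      app_tr := fun h x => PresheafOfModules.naturality_apply f.hom (step h) x
      app_mem := fun p _ _ hx => f.map_mem p hx }
  invFun f :=
    { hom :=
        { app := fun p => ModuleCat.ofHom (f.app p.unop.unop)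
          naturality := fun {p q} k => by
            ext x
            exact f.app_tr (leOfHom k.unop.unop) x }
      map_mem := fun p _ _ hx => f.app_mem p hx }
  left_inv f := rfl
  right_inv f := rfl

end Diagrams

/-! ### Homogeneous components, graded submodules, quotients and direct sums -/

namespace GrDiag
variable {P : Type} [Preorder P] {A : Type} [AddCommGroup A] {S : GradedRings P A}

section Projections
variable (M : GrDiag S) (p : P)

/-- The homogeneous part of degree `a`. -/
noncomputable def proj (a : A) : M.X p →+ M.X p := (M.exists_proj p).choose a

variable {M p}

theorem proj_self {a : A} {x : M.X p} (hx : x ∈ M.gr p a) : M.proj p a x = x :=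
  (M.exists_proj p).choose_spec.1 a x hx

theorem proj_of_ne {a b : A} (hab : a ≠ b) {x : M.X p} (hx : x ∈ M.gr p a) :
    M.proj p b x = 0 :=
  (M.exists_proj p).choose_spec.2 a b hab x hx

theorem gr_induction {motive : M.X p → Prop} (gr : ∀ a, ∀ x ∈ M.gr p a, motive x)
    (zero : motive 0) (add : ∀ x y, motive x → motive y → motive (x + y)) (x : M.X p) :
    motive x := by
  have hx : x ∈ ⨆ a, M.gr p a := by rw [M.iSup_gr]; trivial
  exact AddSubgroup.iSup_induction (C := motive) _ hx gr zero add

theorem proj_mem (a : A) (x : M.X p) : M.proj p a x ∈ M.gr p a := by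
  induction x using gr_induction with
  | gr b x hx =>
    by_cases hab : b = a
    · subst hab
      rwa [proj_self hx]
    · rw [proj_of_ne hab hx]
      exact AddSubgroup.zero_mem _
  | zero => rw [map_zero]; exact AddSubgroup.zero_mem _
  | add x y hx hy => rw [map_add]; exact AddSubgroup.add_mem _ hx hy

theorem exists_sum_proj (x : M.X p) : ∃ s : Finset A, ∑ a ∈ s, M.proj p a x = x := by
  classical
  -- The statement is strengthened to all larger index sets so that the sets for two summands can be
  -- united.
  suffices h : ∃ s : Finset A, ∀ t, s ⊆ t → ∑ a ∈ t, M.proj p a x = x from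
    ⟨_, h.choose_spec _ subset_rfl⟩
  induction x using gr_induction with
  | gr b x hx =>
    refine ⟨{b}, fun t ht => ?_⟩
    rw [Finset.sum_eq_single b, proj_self hx]
    · exact fun a _ hab => proj_of_ne (Ne.symm hab) hx
    · exact fun hb => absurd (ht (Finset.mem_singleton_self b)) hb
  | zero => exact ⟨∅, fun t _ => by simp⟩
  | add x y hx hy =>
    obtain ⟨s, hs⟩ := hx
    obtain ⟨s', hs'⟩ := hy
    refine ⟨s ∪ s', fun t ht => ?_⟩
    simp only [map_add, Finset.sum_add_distrib]
    rw [hs t (Finset.union_subset_left ht), hs' t (Finset.union_subset_right ht)]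

theorem map_proj {N : GrDiag S} {q : P} {F : Type} [FunLike F (M.X p) (N.X q)]
    [AddMonoidHomClass F (M.X p) (N.X q)] (u : F)
    (hu : ∀ a, ∀ x ∈ M.gr p a, u x ∈ N.gr q a) (a : A) (x : M.X p) :
    u (M.proj p a x) = N.proj q a (u x) := by
  induction x using gr_induction with
  | gr b x hx =>
    by_cases hab : b = a
    · subst hab
      rw [proj_self hx, proj_self (hu _ _ hx)]
    · rw [proj_of_ne hab hx, proj_of_ne hab (hu _ _ hx), map_zero]
  | zero => simp only [map_zero]
  | add x y hx hy => simp only [map_add, hx, hy]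

theorem Hom.app_proj {N : GrDiag S} (f : Hom M N) (a : A) (x : M.X p) :
    f.app p (M.proj p a x) = N.proj p a (f.app p x) :=
  map_proj (f.app p) (fun _ _ => f.app_mem p) a x

end Projections

/-- Graded submodules. -/
structure Sub (M : GrDiag S) where
  carrier : ∀ p, Submodule (S.ring.obj p) (M.X p)
  tr_mem : ∀ {p q : P} (h : p ≤ q) {x : M.X p}, x ∈ carrier p → M.tr h x ∈ carrier q
  proj_mem : ∀ (p : P) (a : A) {x : M.X p}, x ∈ carrier p → M.proj p a x ∈ carrier p

namespace Sub
variable {M N : GrDiag S}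

/-- The quotient by a graded submodule. -/
noncomputable def quot (K : Sub M) : GrDiag S where
  X p := M.X p ⧸ K.carrier p
  tr h := Submodule.mapQ _ _ (M.tr h) fun _ hx => K.tr_mem h hx
  tr_refl {p} h x := by
    obtain ⟨x, rfl⟩ := Submodule.mkQ_surjective _ x
    exact congrArg (Submodule.mkQ _) (M.tr_refl h x)
  tr_tr {p q r} h h' x := by
    obtain ⟨x, rfl⟩ := Submodule.mkQ_surjective _ x
    exact congrArg (Submodule.mkQ _) (M.tr_tr h h' x)
  gr p a := (M.gr p a).map (Submodule.mkQ (K.carrier p)).toAddMonoidHom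
  iSup_gr p := by
    rw [← AddSubgroup.map_iSup, M.iSup_gr, ← AddMonoidHom.range_eq_map, AddMonoidHom.range_eq_top]
    exact Submodule.mkQ_surjective _
  exists_proj p := by
    refine ⟨fun a => QuotientAddGroup.map (K.carrier p).toAddSubgroup (K.carrier p).toAddSubgroup
      (M.proj p a) fun x hx => K.proj_mem p a hx, ?_, ?_⟩
    · rintro a _ ⟨x, hx, rfl⟩
      exact congrArg (Submodule.mkQ (K.carrier p)) (proj_self hx)
    · rintro a b hab _ ⟨x, hx, rfl⟩
      exact (congrArg (Submodule.mkQ (K.carrier p)) (proj_of_ne hab hx)).trans (map_zero _)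
  smul_mem p := by
    rintro a b r _ hr ⟨x, hx, rfl⟩
    exact ⟨r • x, M.smul_mem p hr hx, rfl⟩
  tr_mem h := by
    rintro a _ ⟨x, hx, rfl⟩
    exact ⟨M.tr h x, M.tr_mem h hx, rfl⟩

/-- The projection to the quotient. -/
noncomputable def toQuot (K : Sub M) : Hom M K.quot where
  app _ := Submodule.mkQ _
  app_tr _ _ := rfl
  app_mem _ _ _ hx := ⟨_, hx, rfl⟩

theorem toQuot_surjective (K : Sub M) (p : P) : Function.Surjective (K.toQuot.app p) :=
  Submodule.mkQ_surjective _

theorem toQuot_eq_zero (K : Sub M) {p : P} {x : M.X p} : K.toQuot.app p x = 0 ↔ x ∈ K.carrier p :=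
  Submodule.Quotient.mk_eq_zero _

/-- A graded submodule as a graded module. -/
noncomputable def obj (K : Sub M) : GrDiag S where
  X p := K.carrier p
  tr h :=
    { toFun := fun x => ⟨M.tr h x, K.tr_mem h x.2⟩
      map_add' := fun x y => Subtype.ext (map_add (M.tr h) x.1 y.1)
      map_smul' := fun r x => Subtype.ext (map_smulₛₗ (M.tr h) r x.1) }
  tr_refl h x := Subtype.ext (M.tr_refl h x.1)
  tr_tr h h' x := Subtype.ext (M.tr_tr h h' x.1)
  gr p a := (M.gr p a).comap (K.carrier p).subtype.toAddMonoidHom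
  iSup_gr p := by
    rw [eq_top_iff]
    rintro x -
    obtain ⟨s, hs⟩ := exists_sum_proj x.1
    have : x = ∑ a ∈ s, ⟨M.proj p a x, K.proj_mem p a x.2⟩ := by
      apply Subtype.ext
      rw [AddSubmonoidClass.coe_finsetSum]
      exact hs.symm
    rw [this]
    exact AddSubgroup.sum_mem _ fun a _ => AddSubgroup.mem_iSup_of_mem a (GrDiag.proj_mem a x.1)
  exists_proj p := by
    refine ⟨fun a => ((M.proj p a).comp (K.carrier p).subtype.toAddMonoidHom).codRestrict
      (K.carrier p) fun x => K.proj_mem p a x.2, ?_, ?_⟩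
    · exact fun a x hx => Subtype.ext (proj_self hx)
    · exact fun a b hab x hx => Subtype.ext (proj_of_ne hab hx)
  smul_mem p _ _ _ _ hr hx := M.smul_mem p hr hx
  tr_mem h _ _ hx := M.tr_mem h hx

/-- The inclusion of a graded submodule. -/
noncomputable def incl (K : Sub M) : Hom K.obj M where
  app p := (K.carrier p).subtype
  app_tr _ _ := rfl
  app_mem _ _ _ hx := hx

/-- The preimage of a graded submodule. -/
def comap (f : Hom M N) (K : Sub N) : Sub M where
  carrier p := (K.carrier p).comap (f.app p)
  tr_mem h x hx := by
    rw [Submodule.mem_comap, f.app_tr]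
    exact K.tr_mem h hx
  proj_mem p a x hx := by
    rw [Submodule.mem_comap, f.app_proj]
    exact K.proj_mem p a hx

/-- The image of a graded submodule. -/
def map (f : Hom M N) (K : Sub M) : Sub N where
  carrier p := (K.carrier p).map (f.app p)
  tr_mem h := by
    rintro _ ⟨x, hx, rfl⟩
    exact ⟨M.tr h x, K.tr_mem h hx, f.app_tr h x⟩
  proj_mem p a := by
    rintro _ ⟨x, hx, rfl⟩
    exact ⟨M.proj p a x, K.proj_mem p a hx, f.app_proj a x⟩

/-- The kernel of a map. -/
def ker (f : Hom M N) : Sub M where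
  carrier p := LinearMap.ker (f.app p)
  tr_mem h x hx := by
    rw [LinearMap.mem_ker] at hx ⊢
    rw [f.app_tr, hx, map_zero]
  proj_mem p a x hx := by
    rw [LinearMap.mem_ker] at hx ⊢
    rw [f.app_proj, hx, map_zero]

/-- The image of the difference of two maps. -/
def rangeDiff (f g : Hom M N) : Sub N where
  carrier p := LinearMap.range (f.app p - g.app p)
  tr_mem h := by
    rintro _ ⟨x, rfl⟩
    refine ⟨M.tr h x, ?_⟩
    simp only [LinearMap.sub_apply, f.app_tr, g.app_tr, map_sub]
  proj_mem p a := by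
    rintro _ ⟨x, rfl⟩
    refine ⟨M.proj p a x, ?_⟩
    simp only [LinearMap.sub_apply, f.app_proj, g.app_proj, map_sub]

/-- The sum of a family of graded submodules. -/
def iSup {ι : Type} (K : ι → Sub M) : Sub M where
  carrier p := ⨆ i, (K i).carrier p
  tr_mem {p q} h x hx := by
    induction hx using Submodule.iSup_induction' with
    | mem i x hx => exact Submodule.mem_iSup_of_mem i ((K i).tr_mem h hx)
    | zero => rw [map_zero]; exact Submodule.zero_mem _
    | add x y _ _ hx hy => rw [map_add]; exact Submodule.add_mem _ hx hy
  proj_mem p a x hx := by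
    induction hx using Submodule.iSup_induction' with
    | mem i x hx => exact Submodule.mem_iSup_of_mem i ((K i).proj_mem p a hx)
    | zero => rw [map_zero]; exact Submodule.zero_mem _
    | add x y _ _ hx hy => rw [map_add]; exact Submodule.add_mem _ hx hy

end Sub

/-- The map induced on the target of a surjective map. -/
noncomputable def Hom.desc {Z X Y : GrDiag S} (ψ : Hom Z X)
    (hψ : ∀ p, Function.Surjective (ψ.app p)) (u : Hom Z Y)
    (hu : ∀ p x, ψ.app p x = 0 → u.app p x = 0) : Hom X Y where
  app p :=
    { toFun := fun x => u.app p (Function.surjInv (hψ p) x)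
      map_add' := fun x y => by
        rw [← map_add, ← sub_eq_zero, ← map_sub]
        apply hu
        simp only [map_sub, map_add, Function.surjInv_eq, sub_self]
      map_smul' := fun r x => by
        rw [RingHom.id_apply, ← map_smul, ← sub_eq_zero, ← map_sub]
        apply hu
        simp only [map_sub, map_smul, Function.surjInv_eq, sub_self] }
  app_tr h x := by
    change u.app _ (Function.surjInv _ _) = Y.tr h (u.app _ (Function.surjInv _ _))
    rw [← u.app_tr, ← sub_eq_zero, ← map_sub]
    apply hu
    simp only [map_sub, ψ.app_tr, Function.surjInv_eq, sub_self]
  app_mem p a x hx := by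
    change u.app p _ ∈ _
    -- The chosen preimage of `x` need not be homogeneous, but its component of degree `a` is also a
    -- preimage, and `u` cannot tell them apart.
    have : u.app p (Function.surjInv (hψ p) x) =
        u.app p (Z.proj p a (Function.surjInv (hψ p) x)) := by
      rw [← sub_eq_zero, ← map_sub]
      apply hu
      simp only [map_sub, ψ.app_proj, Function.surjInv_eq]
      rw [proj_self hx, sub_self]
    rw [this]
    exact u.app_mem p (proj_mem a _)

theorem Hom.desc_app {Z X Y : GrDiag S} (ψ : Hom Z X)
    (hψ : ∀ p, Function.Surjective (ψ.app p)) (u : Hom Z Y)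
    (hu : ∀ p x, ψ.app p x = 0 → u.app p x = 0) (p : P) (z : Z.X p) :
    (ψ.desc hψ u hu).app p (ψ.app p z) = u.app p z := by
  change u.app p (Function.surjInv (hψ p) _) = _
  rw [← sub_eq_zero, ← map_sub]
  apply hu
  rw [map_sub, Function.surjInv_eq (hψ p), sub_self]

section DirectSum
variable {J : Type} (M : J → GrDiag S)

/-- The direct sum of a family of graded modules. -/
noncomputable def directSum : GrDiag S where
  X p := Π₀ j, (M j).X p
  tr h :=
    { toFun := DFinsupp.mapRange (fun j => (M j).tr h) fun j => map_zero _
      map_add' := fun x y => DFinsupp.ext fun j => by simp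
      map_smul' := fun r x => DFinsupp.ext fun j => by
        simp [map_smulₛₗ] }
  tr_refl h x := DFinsupp.ext fun j => by simp [(M j).tr_refl]
  tr_tr h h' x := DFinsupp.ext fun j => by simp [(M j).tr_tr]
  gr p a :=
    { carrier := {z | ∀ j, z j ∈ (M j).gr p a}
      zero_mem' := fun j => AddSubgroup.zero_mem _
      add_mem' := fun hx hy j => AddSubgroup.add_mem _ (hx j) (hy j)
      neg_mem' := fun hx j => AddSubgroup.neg_mem _ (hx j) }
  iSup_gr p := by
    classical
    rw [eq_top_iff]
    rintro x -
    induction x using DFinsupp.induction with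
    | h0 => exact AddSubgroup.zero_mem _
    | ha j x y _ hx0 hy =>
      clear hx0
      refine AddSubgroup.add_mem _ ?_ hy
      clear hy
      induction x using gr_induction with
      | zero => rw [DFinsupp.single_zero]; exact AddSubgroup.zero_mem _
      | add x y hx hy => rw [DFinsupp.single_add]; exact AddSubgroup.add_mem _ hx hy
      | gr a x hx =>
        refine AddSubgroup.mem_iSup_of_mem a fun i => ?_
        by_cases hij : j = i
        · subst hij
          rwa [DFinsupp.single_eq_same]
        · rw [DFinsupp.single_eq_of_ne (Ne.symm hij)]
          exact AddSubgroup.zero_mem _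
  exists_proj p := by
    refine ⟨fun a => DFinsupp.mapRange.addMonoidHom fun j => (M j).proj p a, ?_, ?_⟩
    · exact fun a x hx => DFinsupp.ext fun j => by simpa using proj_self (hx j)
    · exact fun a b hab x hx => DFinsupp.ext fun j => by simpa using proj_of_ne hab (hx j)
  smul_mem p _ _ _ _ hr hx j := (M j).smul_mem p hr (hx j)
  tr_mem h _ _ hx j := (M j).tr_mem h (hx j)

open Classical in
/-- The inclusion of a summand. -/
noncomputable def inj (j : J) : Hom (M j) (directSum M) where
  app p := DFinsupp.lsingle (M := fun j => (M j).X p) j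
  app_tr h x := (DFinsupp.mapRange_single (f := fun j => (M j).tr h)
    (hf := fun j => map_zero ((M j).tr h))).symm
  app_mem p a x hx i := by
    change (DFinsupp.single j x : Π₀ j, (M j).X p) i ∈ _
    by_cases hij : j = i
    · subst hij
      rwa [DFinsupp.single_eq_same]
    · rw [DFinsupp.single_eq_of_ne (Ne.symm hij)]
      exact AddSubgroup.zero_mem _

variable {M}

theorem directSum_induction {p : P} {motive : (directSum M).X p → Prop} (zero : motive 0)
    (add : ∀ x y, motive x → motive y → motive (x + y))
    (inj : ∀ j x, motive ((inj M j).app p x)) (x : (directSum M).X p) : motive x := by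
  classical
  have key : ∀ y : Π₀ j, (M j).X p, motive y := by
    intro y
    induction y using DFinsupp.induction with
    | h0 => exact zero
    | ha j x y _ _ hy =>
      refine add _ _ ?_ hy
      convert inj j x using 1
      simp only [GrDiag.inj]
      congr!
  exact key x

open Classical in
/-- The linear map on a direct sum given by maps on the summands. -/
noncomputable def lsum {p : P} {N : Type} [AddCommGroup N] [Module (S.ring.obj p) N]
    (f : ∀ j, (M j).X p →ₗ[S.ring.obj p] N) : (directSum M).X p →ₗ[S.ring.obj p] N :=
  DFinsupp.lsum ℕ f

theorem lsum_inj {p : P} {N : Type} [AddCommGroup N] [Module (S.ring.obj p) N]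
    (f : ∀ j, (M j).X p →ₗ[S.ring.obj p] N) (j : J) (x : (M j).X p) :
    lsum f ((inj M j).app p x) = f j x :=
  letI := Classical.decEq J
  DFinsupp.lsum_single (M := fun j => (M j).X p) ℕ f j x

/-- The map on a direct sum given by maps on the summands. -/
noncomputable def sumDesc {N : GrDiag S} (f : ∀ j, Hom (M j) N) : Hom (directSum M) N where
  app p := lsum fun j => (f j).app p
  app_tr h x := by
    induction x using directSum_induction with
    | zero => simp only [map_zero]
    | add x y hx hy => simp only [map_add, hx, hy]
    | inj j x => rw [← (inj M j).app_tr, lsum_inj, lsum_inj, (f j).app_tr]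
  app_mem p a x hx := by
    -- Writing `x` as its own component of degree `a` frees the induction from the homogeneity
    -- hypothesis, which the summands would not inherit in a usable form.
    rw [← proj_self hx]
    clear hx
    induction x using directSum_induction with
    | zero => simp only [map_zero, AddSubgroup.zero_mem]
    | add x y hx hy => rw [map_add, map_add]; exact AddSubgroup.add_mem _ hx hy
    | inj j x =>
      rw [← (inj M j).app_proj, lsum_inj]
      exact (f j).app_mem p (proj_mem a x)

theorem sumDesc_inj {N : GrDiag S} (f : ∀ j, Hom (M j) N) (j : J) {p : P} (x : (M j).X p) :
    (sumDesc f).app p ((inj M j).app p x) = (f j).app p x :=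
  lsum_inj _ j x

end DirectSum

end GrDiag

/-! ### Modules extended along a class of maps, and generated submodules -/

namespace GrDiag
variable {P : Type} [Preorder P] {A : Type} [AddCommGroup A] {S : GradedRings P A}
  {W : ∀ {p q : P}, p ≤ q → Prop}

variable (W) in
/-- The structure maps in the class `W` are extensions of scalars. -/
def IsExtOn (M : GrDiag S) : Prop := ∀ (p q : P) (h : p ≤ q), W h → IsBaseExt (M.tr h)

variable (W) in
/-- For `p ≤ q` in the class `W`, the value at `q` is generated by the value at `p`. -/
def Sub.IsGen {M : GrDiag S} (K : Sub M) : Prop := ∀ (p q : P) (h : p ≤ q), W h →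
  ∀ x ∈ K.carrier q, x ∈ Submodule.span (S.ring.obj q) (M.tr h '' (K.carrier p : Set (M.X p)))

/-- Right exactness: the extension of a quotient is the quotient of the extension by the span of the
image of the submodule, and `IsGen` says that this span contains `K.carrier q`. -/
theorem IsExtOn.quot {M : GrDiag S} (hM : M.IsExtOn W) (K : Sub M) (hK : K.IsGen W) :
    K.quot.IsExtOn W := by
  intro p q h hW
  have hM := hM p q h hW
  constructor
  · have h1 : Set.range (K.quot.tr h) = K.toQuot.app q '' Set.range (M.tr h) := by
      rw [← Set.range_comp]
      ext y
      constructor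
      · rintro ⟨x, rfl⟩
        obtain ⟨x, rfl⟩ := K.toQuot_surjective p x
        exact ⟨x, rfl⟩
      · rintro ⟨x, rfl⟩
        exact ⟨K.toQuot.app p x, rfl⟩
    rw [h1, Submodule.span_image, hM.span_eq_top, Submodule.map_top, LinearMap.range_eq_top]
    exact K.toQuot_surjective q
  · intro N _ _ g
    let g' : M.X p →ₛₗ[S.tr h] N := g.comp (K.toQuot.app p)
    obtain ⟨k, hk⟩ := hM.exists_lift N g'
    have hker : K.carrier q ≤ LinearMap.ker k := by
      intro x hx
      refine Submodule.span_le.mpr ?_ (hK p q h hW x hx)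
      rintro _ ⟨y, hy, rfl⟩
      change k _ = 0
      rw [hk]
      change g (K.toQuot.app p y) = 0
      rw [K.toQuot_eq_zero.mpr hy, map_zero]
    refine ⟨(K.carrier q).liftQ k hker, fun x => ?_⟩
    obtain ⟨x, rfl⟩ := K.toQuot_surjective p x
    exact hk x

theorem IsExtOn.directSum {J : Type} {M : J → GrDiag S} (hM : ∀ j, (M j).IsExtOn W) :
    (directSum M).IsExtOn W := by
  intro p q h hW
  constructor
  · rw [eq_top_iff]
    rintro x -
    induction x using directSum_induction with
    | zero => exact Submodule.zero_mem _
    | add x y hx hy => exact Submodule.add_mem _ hx hy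
    | inj j x =>
      have hx : x ∈ Submodule.span (S.ring.obj q) (Set.range ((M j).tr h)) := by
        rw [(hM j p q h hW).span_eq_top]; trivial
      have := Submodule.mem_map_of_mem (f := (inj M j).app q) hx
      rw [← Submodule.span_image] at this
      refine Submodule.span_mono ?_ this
      rintro _ ⟨_, ⟨y, rfl⟩, rfl⟩
      exact ⟨(inj M j).app p y, ((inj M j).app_tr h y).symm⟩
  · intro N _ _ g
    choose k hk using fun j => (hM j p q h hW).exists_lift N (g.comp ((inj M j).app p))
    refine ⟨lsum k, fun x => ?_⟩
    induction x using directSum_induction with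
    | zero => simp only [map_zero]
    | add x y hx hy => simp only [map_add, hx, hy]
    | inj j x => rw [← (inj M j).app_tr, lsum_inj, hk]; rfl

/-- The converse use of right exactness. With `T` the span of the image of the kernel at `p`, the
map from `Z.X p` to `Z.X q ⧸ T` factors through `X.X p`, hence extends to `X.X q`. So the projection
modulo `T` factors through `ψ` and the kernel of `ψ` at `q` lies in `T`. -/
theorem Sub.isGen_ker {Z X : GrDiag S} (hZ : Z.IsExtOn W) (hX : X.IsExtOn W) (ψ : Hom Z X)
    (hψ : ∀ p, Function.Surjective (ψ.app p)) : (ker ψ).IsGen W := by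
  intro p q h hW z hz
  set T := Submodule.span (S.ring.obj q) (Z.tr h '' ((ker ψ).carrier p : Set (Z.X p)))
  -- By the choice of `T`, `mk` depends only on the image under `ψ`, so it may be evaluated on
  -- arbitrary preimages.
  let mk : Z.X p → Z.X q ⧸ T := fun y => T.mkQ (Z.tr h y)
  have hmk : ∀ y y', ψ.app p y = ψ.app p y' → mk y = mk y' := by
    intro y y' hy
    refine (Submodule.Quotient.eq T).mpr ?_
    rw [← map_sub]
    refine Submodule.subset_span ⟨_, ?_, rfl⟩
    change ψ.app p (y - y') = 0
    rw [map_sub, hy, sub_self]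
  let g : X.X p →ₛₗ[S.tr h] Z.X q ⧸ T :=
    { toFun := fun x => mk (Function.surjInv (hψ p) x)
      map_add' := fun x y => by
        have : mk (Function.surjInv (hψ p) x) + mk (Function.surjInv (hψ p) y) =
            mk (Function.surjInv (hψ p) x + Function.surjInv (hψ p) y) := by
          simp only [mk, map_add]
        rw [this]
        apply hmk
        rw [map_add, Function.surjInv_eq (hψ p), Function.surjInv_eq (hψ p),
          Function.surjInv_eq (hψ p)]
      map_smul' := fun r x => by
        have : S.tr h r • mk (Function.surjInv (hψ p) x) =
            mk (r • Function.surjInv (hψ p) x) := by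
          simp only [mk, map_smulₛₗ, RingHom.id_apply]
        rw [this]
        apply hmk
        rw [map_smul, Function.surjInv_eq (hψ p), Function.surjInv_eq (hψ p)] }
  obtain ⟨k, hk⟩ := (hX p q h hW).exists_lift _ g
  have hcomp : k ∘ₗ ψ.app q = T.mkQ := by
    refine (hZ p q h hW).hom_ext fun y => ?_
    rw [LinearMap.comp_apply, ψ.app_tr, hk]
    exact hmk _ _ (Function.surjInv_eq (hψ p) _)
  rw [← Submodule.Quotient.mk_eq_zero T]
  change T.mkQ z = 0
  rw [← hcomp, LinearMap.comp_apply, show ψ.app q z = 0 from hz, map_zero]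

theorem Sub.IsGen.map {M N : GrDiag S} (f : Hom M N) {K : Sub M} (hK : K.IsGen W) :
    (K.map f).IsGen W := by
  rintro p q h hW _ ⟨x, hx, rfl⟩
  have := Submodule.mem_map_of_mem (f := f.app q) (hK p q h hW x hx)
  rw [← Submodule.span_image] at this
  refine Submodule.span_mono ?_ this
  rintro _ ⟨_, ⟨y, hy, rfl⟩, rfl⟩
  exact ⟨f.app p y, ⟨y, hy, rfl⟩, (f.app_tr h y).symm⟩

theorem Sub.IsGen.iSup {M : GrDiag S} {ι : Type} {K : ι → Sub M} (hK : ∀ i, (K i).IsGen W) :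
    (Sub.iSup K).IsGen W := by
  intro p q h hW x hx
  change x ∈ ⨆ i, (K i).carrier q at hx
  refine (iSup_le fun i y hy => ?_ : ⨆ i, (K i).carrier q ≤ _) hx
  refine Submodule.span_mono (Set.image_mono ?_) (hK i p q h hW y hy)
  exact fun y hy => Submodule.mem_iSup_of_mem i hy

theorem Sub.isGen_rangeDiff {X N : GrDiag S} (hX : X.IsExtOn W) (f g : Hom X N) :
    (rangeDiff f g).IsGen W := by
  rintro p q h hW _ ⟨x, rfl⟩
  have hx : x ∈ Submodule.span (S.ring.obj q) (Set.range (X.tr h)) := by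
    rw [(hX p q h hW).span_eq_top]; trivial
  have := Submodule.mem_map_of_mem (f := f.app q - g.app q) hx
  rw [← Submodule.span_image] at this
  refine Submodule.span_mono ?_ this
  rintro _ ⟨_, ⟨y, rfl⟩, rfl⟩
  refine ⟨(f.app p - g.app p) y, ⟨y, rfl⟩, ?_⟩
  simp only [LinearMap.sub_apply, f.app_tr, g.app_tr, map_sub]

/-- Generated submodules are closed under extensions: an element of the preimage agrees modulo `K`
with a combination of elements coming from `p`, and the error in `K` is generated too. -/
theorem Sub.IsGen.comap_toQuot {M : GrDiag S} {K : Sub M} (hK : K.IsGen W) {T : Sub K.quot}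
    (hT : T.IsGen W) : (T.comap K.toQuot).IsGen W := by
  intro p q h hW x hx
  have h1 := hT p q h hW _ hx
  have h2 : K.quot.tr h '' (T.carrier p : Set (K.quot.X p)) =
      K.toQuot.app q '' (M.tr h '' ((T.comap K.toQuot).carrier p : Set (M.X p))) := by
    ext y
    constructor
    · rintro ⟨z, hz, rfl⟩
      obtain ⟨z, rfl⟩ := K.toQuot_surjective p z
      exact ⟨_, ⟨z, hz, rfl⟩, rfl⟩
    · rintro ⟨_, ⟨z, hz, rfl⟩, rfl⟩
      exact ⟨_, hz, rfl⟩
  rw [h2, Submodule.span_image] at h1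
  obtain ⟨y, hy, hyx⟩ := h1
  have h3 : x - y ∈ K.carrier q := by
    rw [← K.toQuot_eq_zero, map_sub, hyx, sub_self]
  rw [← sub_add_cancel x y]
  refine Submodule.add_mem _ (Submodule.span_mono (Set.image_mono ?_) (hK p q h hW _ h3)) hy
  intro z hz
  change K.toQuot.app p z ∈ T.carrier p
  rw [K.toQuot_eq_zero.mpr hz]
  exact Submodule.zero_mem _

end GrDiag

/-! ### Small submodules and a generating set -/

namespace GrDiag
variable {P : Type} [Preorder P] {A : Type} [AddCommGroup A] {S : GradedRings P A}
  {W : ∀ {p q : P}, p ≤ q → Prop}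

variable (S) in
/-- Formal expressions in one element, for the closure process that produces small submodules. -/
inductive Term : Type
  | base : Term
  | lin (p : P) (n : ℕ) (r : Fin n → S.ring.obj p) (t : Fin n → Term) : Term
  | tr {p q : P} (h : p ≤ q) (t : Term) : Term
  | proj (p : P) (a : A) (t : Term) : Term
  | gen {p q : P} (h : p ≤ q) (k : ℕ) (t : Term) : Term
  | rel {p q : P} (h : p ≤ q) (n : ℕ) (r : Fin n → S.ring.obj q) (k : ℕ) (t : Fin n → Term) : Term

section Eval
variable {X : GrDiag S} (x₀ : ∀ p, X.X p) (g : ∀ {p q : P}, p ≤ q → X.X q → List (X.X p))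
  (l : ∀ {p q : P}, p ≤ q → ∀ n, (Fin n → S.ring.obj q) → (Fin n → X.X p) → List (X.X p))

open Classical in
/-- The value of an expression, given lists of generators `g` and of witnesses for relations `l`. -/
noncomputable def Term.eval : Term S → ∀ p, X.X p
  | base => x₀
  -- An expression has a value at every index, zero away from the intended one, so expressions need
  -- no typing by index.
  | lin p _ r t => Pi.single p (∑ i, r i • (t i).eval p)
  | tr (p := p) (q := q) h t => Pi.single q (X.tr h (t.eval p))
  | proj p a t => Pi.single p (X.proj p a (t.eval p))
  -- The number `k` selects an entry of the list; the default `0` beyond its end adds nothing to a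
  -- submodule.
  | gen (p := p) (q := q) h k t => Pi.single p ((g h (t.eval q)).getD k 0)
  | rel (p := p) h n r k t => Pi.single p ((l h n r fun i => (t i).eval p).getD k 0)

/-- The graded submodule of all values of expressions. -/
noncomputable def Sub.closure : Sub X where
  carrier p :=
    { carrier := Set.range fun t : Term S => t.eval x₀ g l p
      zero_mem' := ⟨.lin p 0 ![] ![], by simp [Term.eval]⟩
      add_mem' := by
        rintro _ _ ⟨t, rfl⟩ ⟨t', rfl⟩
        exact ⟨.lin p 2 ![1, 1] ![t, t'], by simp [Term.eval]⟩
      smul_mem' := by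
        rintro r _ ⟨t, rfl⟩
        exact ⟨.lin p 1 ![r] ![t], by simp [Term.eval]⟩ }
  tr_mem h := by
    rintro _ ⟨t, rfl⟩
    exact ⟨.tr h t, by simp [Term.eval]⟩
  proj_mem p a := by
    rintro _ ⟨t, rfl⟩
    exact ⟨.proj p a t, by simp [Term.eval]⟩

variable {x₀ g l}

theorem Sub.mem_closure_of_mem_gen {p q : P} (h : p ≤ q) {x : X.X q}
    (hx : x ∈ (closure x₀ g l).carrier q) {y : X.X p} (hy : y ∈ g h x) :
    y ∈ (closure x₀ g l).carrier p := by
  obtain ⟨t, rfl⟩ := hx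
  obtain ⟨k, hk, rfl⟩ := List.getElem_of_mem hy
  exact ⟨.gen h k t, by simp [Term.eval, hk]⟩

theorem Sub.mem_closure_of_mem_rel {p q : P} (h : p ≤ q) {n : ℕ} (r : Fin n → S.ring.obj q)
    {x : Fin n → X.X p} (hx : ∀ i, x i ∈ (closure x₀ g l).carrier p) {y : X.X p}
    (hy : y ∈ l h n r x) : y ∈ (closure x₀ g l).carrier p := by
  choose t ht using hx
  -- The list `l` depends on the elements themselves, so `x` must be exactly the tuple of values of
  -- the expressions.
  obtain rfl : (fun i => (t i).eval x₀ g l p) = x := funext ht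
  obtain ⟨k, hk, rfl⟩ := List.getElem_of_mem hy
  exact ⟨.rel h n r k t, by simp [Term.eval, hk]⟩

end Eval

/-- Every element of a module in the class lies in a small submodule in the class. -/
theorem IsExtOn.exists_small {X : GrDiag S} (hX : X.IsExtOn W) {p : P} (x : X.X p) :
    ∃ K : Sub X, K.obj.IsExtOn W ∧ x ∈ K.carrier p ∧
      ∃ e : Term S → ∀ p, K.obj.X p, ∀ p, Function.Surjective fun t => e t p := by
  classical
  -- Finitely many elements at `p` whose images span a submodule containing `x`. For `h` outside `W`
  -- the empty list serves, so that the choice is total.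
  have hg : ∀ {p q : P} (h : p ≤ q) (x : X.X q), ∃ L : List (X.X p), W h →
      x ∈ Submodule.span (S.ring.obj q) (X.tr h '' {y | y ∈ L}) := by
    intro p q h x
    by_cases hW : W h
    · have hx : x ∈ Submodule.span (S.ring.obj q) (Set.range (X.tr h)) := by
        rw [(hX p q h hW).span_eq_top]; trivial
      obtain ⟨c, rfl⟩ := Finsupp.mem_span_range_iff_exists_finsupp.mp hx
      refine ⟨c.support.toList, fun _ => Submodule.sum_mem _ fun y hy => ?_⟩
      exact Submodule.smul_mem _ _ (Submodule.subset_span ⟨y, Finset.mem_toList.mpr hy, rfl⟩)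
    · exact ⟨[], fun h' => absurd h' hW⟩
  -- Finitely many elements at `p` whose presence in a submodule forces the given relation in every
  -- semilinear image of it; the list is empty if `h` is not in `W` or the relation fails.
  have hl : ∀ {p q : P} (h : p ≤ q) (n : ℕ) (r : Fin n → S.ring.obj q) (x : Fin n → X.X p),
      ∃ L : List (X.X p), W h → ∑ i, r i • X.tr h (x i) = 0 →
        ∀ V : Submodule (S.ring.obj p) (X.X p), (∀ y ∈ L, y ∈ V) → ∀ hV : ∀ i, x i ∈ V,
          ∀ (N : Type) [AddCommGroup N] [Module (S.ring.obj q) N] (g : V →ₛₗ[S.tr h] N),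
            ∑ i, r i • g ⟨x i, hV i⟩ = 0 := by
    intro p q h n r x
    by_cases hW : W h
    · by_cases h0 : ∑ i, r i • X.tr h (x i) = 0
      · obtain ⟨L, hL⟩ := (hX p q h hW).exists_list r x h0
        exact ⟨L, fun _ _ => hL⟩
      · exact ⟨[], fun _ h' => absurd h' h0⟩
    · exact ⟨[], fun h' => absurd h' hW⟩
  choose g hg using @hg
  choose l hl using @hl
  let K := Sub.closure (Pi.single p x) g l
  refine ⟨K, fun p q h hW => ?_, ⟨.base, by simp [Term.eval]⟩,
    fun t p => ⟨_, t, rfl⟩, fun p => ?_⟩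
  -- Closure under `g` gives spanning, and closure under `l` makes every relation in `X` between
  -- elements of `K` hold under semilinear maps out of `K`.
  · apply IsBaseExt.of_relations
    · rw [eq_top_iff]
      rintro x -
      have h1 := hg h x.1 hW
      have h2 : X.tr h '' {y | y ∈ g h x.1} ⊆
          (K.carrier q).subtype '' Set.range (K.obj.tr h) := by
        rintro _ ⟨y, hy, rfl⟩
        exact ⟨_, ⟨⟨y, Sub.mem_closure_of_mem_gen h x.2 hy⟩, rfl⟩, rfl⟩
      have h3 := Submodule.span_mono (R := S.ring.obj q) h2 h1
      rw [Submodule.span_image] at h3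
      obtain ⟨x', hx', hxx⟩ := h3
      obtain rfl : x' = x := Subtype.ext hxx
      exact hx'
    · intro n r x hx N _ _ k
      have h1 : ∑ i, r i • X.tr h (x i).1 = 0 := by
        have := congrArg (K.incl.app q) hx
        simp only [map_sum, map_smul, map_zero] at this
        exact this
      exact hl h n r (fun i => (x i).1) hW h1 (K.carrier p)
        (fun y hy => Sub.mem_closure_of_mem_rel h r (fun i => (x i).2) hy) (fun i => (x i).2) N k
  · rintro ⟨_, t, rfl⟩
    exact ⟨t, rfl⟩

variable (S) in
/-- Elementary statements about a module whose elements are named by expressions. -/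
inductive Atom : Type
  | lin (p : P) (r s : S.ring.obj p) (t t' t'' : Term S) : Atom
  | tr {p q : P} (h : p ≤ q) (t t' : Term S) : Atom
  | gr (p : P) (a : A) (t : Term S) : Atom

/-- The elementary statements that hold in a module, with respect to a naming of its elements. -/
def Atom.Holds {X : GrDiag S} (e : Term S → ∀ p, X.X p) : Atom S → Prop
  | lin p r s t t' t'' => r • e t p + s • e t' p = e t'' p
  | tr (p := p) (q := q) h t t' => X.tr h (e t p) = e t' q
  | gr p a t => e t p ∈ X.gr p a

/-- Sending the element named by an expression in `X` to the one it names in `Y` is well defined and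
a map of graded modules, because equality, linear operations, structure maps and degrees are all
expressed by atoms. -/
theorem exists_hom_of_holds_iff {X Y : GrDiag S} (e : Term S → ∀ p, X.X p)
    (he : ∀ p, Function.Surjective fun t => e t p) (e' : Term S → ∀ p, Y.X p)
    (he' : ∀ p, Function.Surjective fun t => e' t p)
    (H : ∀ φ : Atom S, φ.Holds e → φ.Holds e') :
    ∃ f : Hom X Y, ∀ p, Function.Surjective (f.app p) := by
  have heq : ∀ {p} {t t' : Term S}, e t p = e t' p → e' t p = e' t' p := by
    intro p t t' h
    -- With coefficients `1` and `0`, a linear atom expresses equality of two named elements.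
    have := H (.lin p 1 0 t t t') (by simpa [Atom.Holds] using h)
    simpa [Atom.Holds] using this
  let f : ∀ p, X.X p → Y.X p := fun p x => e' (Function.surjInv (he p) x) p
  have hf : ∀ p t, f p (e t p) = e' t p := fun p t => heq (Function.surjInv_eq (he p) (e t p))
  refine ⟨⟨fun p => ⟨⟨f p, ?_⟩, ?_⟩, ?_, ?_⟩, ?_⟩
  · intro x y
    obtain ⟨t, rfl⟩ := he p x
    obtain ⟨t', rfl⟩ := he p y
    obtain ⟨t'', ht⟩ := he p (e t p + e t' p)
    have := H (.lin p 1 1 t t' t'') (by simpa [Atom.Holds] using ht.symm)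
    simp only [Atom.Holds, one_smul] at this ht ⊢
    rw [← ht, hf, hf, hf, this]
  · intro r x
    obtain ⟨t, rfl⟩ := he p x
    obtain ⟨t'', ht⟩ := he p (r • e t p)
    have := H (.lin p r 0 t t t'') (by simpa [Atom.Holds] using ht.symm)
    simp only [Atom.Holds, zero_smul, add_zero] at this ht
    change f p (r • e t p) = r • f p (e t p)
    rw [← ht, hf, hf, this]
  · intro p q h x
    obtain ⟨t, rfl⟩ := he p x
    obtain ⟨t', ht⟩ := he q (X.tr h (e t p))
    have := H (.tr h t t') ht.symm
    simp only [Atom.Holds] at this ht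
    change f q (X.tr h (e t p)) = Y.tr h (f p (e t p))
    rw [← ht, hf, hf, this]
  · intro p a x hx
    obtain ⟨t, rfl⟩ := he p x
    change f p (e t p) ∈ _
    rw [hf]
    exact H (.gr p a t) hx
  · intro p y
    obtain ⟨t, rfl⟩ := he' p y
    exact ⟨e t p, hf p t⟩

variable (S W) in
/-- A set of modules in the class that generates the class: every element of every module in the
class is the image of an element of a module in the set. -/
theorem exists_generators : ∃ (J : Type) (Y : J → GrDiag S), (∀ j, (Y j).IsExtOn W) ∧
    ∀ X : GrDiag S, X.IsExtOn W → ∀ (p : P) (x : X.X p),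
      ∃ (j : J) (f : Hom (Y j) X), x ∈ Set.range (f.app p) := by
  -- Indexing by the sets of true atoms instead of by the modules keeps `J` in `Type`; one module is
  -- chosen for each realized set.
  let J : Type := {s : Set (Atom S) // ∃ (Y : GrDiag S) (e : Term S → ∀ p, Y.X p),
    Y.IsExtOn W ∧ (∀ p, Function.Surjective fun t => e t p) ∧ {φ | φ.Holds e} = s}
  choose Y e hY he hs using fun j : J => j.2
  refine ⟨J, Y, hY, fun X hX p x => ?_⟩
  obtain ⟨K, hK, hx, e', he'⟩ := hX.exists_small x
  let j : J := ⟨{φ | φ.Holds e'}, K.obj, e', hK, he', rfl⟩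
  obtain ⟨f, hf⟩ := exists_hom_of_holds_iff (e j) (he j) e' he' fun φ hφ => by
    have : φ ∈ {φ | φ.Holds (e j)} := hφ
    rw [hs j] at this
    exact this
  obtain ⟨y, hy⟩ := hf p ⟨x, hx⟩
  exact ⟨j, K.incl.comp f, y, congrArg Subtype.val hy⟩

end GrDiag

/-! ### The coreflection -/

namespace GrDiag
variable {P : Type} [Preorder P] {A : Type} [AddCommGroup A] {S : GradedRings P A}
  {W : ∀ {p q : P}, p ≤ q → Prop}

theorem sumDesc_surjective {J : Type} {M : J → GrDiag S} {N : GrDiag S} (f : ∀ j, Hom (M j) N)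
    (hf : ∀ p (x : N.X p), ∃ j, x ∈ Set.range ((f j).app p)) (p : P) :
    Function.Surjective ((sumDesc f).app p) := by
  intro x
  obtain ⟨j, y, rfl⟩ := hf p x
  exact ⟨_, sumDesc_inj f j y⟩

variable (W) in
/-- Every graded module `M` has a coreflection in the class: a quotient of the sum of all
generators over `M` by the largest possible submodule. -/
theorem exists_coreflection (M : GrDiag S) : ∃ (Γ : GrDiag S) (ε : Hom Γ M), Γ.IsExtOn W ∧
    ∀ X : GrDiag S, X.IsExtOn W → ∀ f : Hom X M, ∃! g : Hom X Γ, ε.comp g = f := by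
  obtain ⟨J, Y, hY, hJ⟩ := exists_generators S W
  let Z : GrDiag S := directSum fun i : (j : J) × Hom (Y j) M => Y i.1
  have hZ : Z.IsExtOn W := IsExtOn.directSum fun i => hY i.1
  let φ : Hom Z M := sumDesc fun i => i.2
  -- The sum of all generated submodules killed by `φ` is the largest such submodule.
  let ι : Type := {K : Sub Z // K.IsGen W ∧ ∀ p, ∀ x ∈ K.carrier p, φ.app p x = 0}
  let K : Sub Z := Sub.iSup fun i : ι => i.1
  have hK : K.IsGen W := Sub.IsGen.iSup fun i => i.2.1
  have le_K : ∀ K' : Sub Z, K'.IsGen W → (∀ p, ∀ x ∈ K'.carrier p, φ.app p x = 0) →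
      ∀ p, K'.carrier p ≤ K.carrier p := fun K' h h' p =>
    le_iSup (fun i : ι => i.1.carrier p) ⟨K', h, h'⟩
  have hKφ : ∀ p, ∀ x ∈ K.carrier p, φ.app p x = 0 := fun p x hx =>
    (iSup_le fun i x hx => i.2.2 p x hx :
      ⨆ i : ι, i.1.carrier p ≤ LinearMap.ker (φ.app p)) hx
  let ε : Hom K.quot M := K.toQuot.desc K.toQuot_surjective φ fun p x hx =>
    hKφ p x (K.toQuot_eq_zero.mp hx)
  have hε : ∀ p x, ε.app p (K.toQuot.app p x) = φ.app p x := fun p x => Hom.desc_app _ _ _ _ p x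
  refine ⟨K.quot, ε, hZ.quot K hK, fun X hX f => ?_⟩
  refine existsUnique_of_exists_of_unique ?_ ?_
  · let ψ := sumDesc fun i : (j : J) × Hom (Y j) X => i.2
    have hψ : ∀ p, Function.Surjective (ψ.app p) := sumDesc_surjective _ fun p x => by
      obtain ⟨j, g, hg⟩ := hJ X hX p x
      exact ⟨⟨j, g⟩, hg⟩
    -- The summand of a map `g : Y j → X` goes identically to the summand of `f ∘ g : Y j → M`; thus
    -- `φ ∘ θ = f ∘ ψ`.
    let θ : Hom (directSum fun i : (j : J) × Hom (Y j) X => Y i.1) Z := sumDesc fun i =>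
      inj (fun i : (j : J) × Hom (Y j) M => Y i.1) ⟨i.1, f.comp i.2⟩
    have hθ : ∀ p x, φ.app p (θ.app p x) = f.app p (ψ.app p x) := by
      intro p x
      induction x using directSum_induction with
      | zero => simp only [map_zero]
      | add x y hx hy => simp only [map_add, hx, hy]
      | inj i x =>
        rw [sumDesc_inj, sumDesc_inj, sumDesc_inj]
        rfl
    -- The image under `θ` of the kernel of `ψ` is generated and killed by `φ`, so maximality puts
    -- it in `K` and `θ` descends to `X`.
    have hker := (Sub.isGen_ker
      (IsExtOn.directSum fun i : (j : J) × Hom (Y j) X => hY i.1) hX ψ hψ).map θ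
    have hle := le_K _ hker (by
      rintro p _ ⟨x, hx, rfl⟩
      rw [hθ, show ψ.app p x = 0 from hx, map_zero])
    let g : Hom X K.quot := ψ.desc hψ (K.toQuot.comp θ) fun p x hx =>
      K.toQuot_eq_zero.mpr (hle p ⟨x, hx, rfl⟩)
    refine ⟨g, Hom.ext (funext fun p => LinearMap.ext fun x => ?_)⟩
    obtain ⟨z, rfl⟩ := hψ p x
    change ε.app p (g.app p (ψ.app p z)) = _
    have hg : g.app p (ψ.app p z) = K.toQuot.app p (θ.app p z) := Hom.desc_app _ _ _ _ p z
    rw [hg, hε, hθ]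
  · intro g g' hg hg'
    -- The preimage in `Z` of the image of `g - g'` is generated and killed by `φ`; by maximality it
    -- lies in `K`, so the difference is zero in the quotient.
    have hgen := hK.comap_toQuot (Sub.isGen_rangeDiff hX g g')
    have hle := le_K _ hgen (by
      rintro p x ⟨y, hy⟩
      rw [← hε, ← hy, LinearMap.sub_apply, map_sub, sub_eq_zero]
      exact LinearMap.congr_fun (congrFun (congrArg Hom.app (hg.trans hg'.symm)) p) y)
    refine Hom.ext (funext fun p => LinearMap.ext fun y => ?_)
    obtain ⟨x, hx⟩ := K.toQuot_surjective p (g.app p y - g'.app p y)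
    have hxK : x ∈ K.carrier p := hle p ⟨y, hx.symm⟩
    rw [← sub_eq_zero, ← hx, K.toQuot_eq_zero]
    exact hxK

end GrDiag

/-! ### From coreflections to adjoint functors -/

section Adjunctions
variable {P : Type} [Preorder P] {A : Type} [AddCommGroup A] {S : GradedRings P A}

variable (S) in
/-- The graded modules for which the structure maps in the class `W` are extensions of scalars. -/
def TorusModel.GrMod.extOn (W : ∀ {p q : P}, p ≤ q → Prop) : ObjectProperty (GrMod S) := fun M =>
  ∀ (p q : P) (h : p ≤ q), W h → M.IsExtension h

theorem TorusModel.GrMod.extOn_iff {W : ∀ {p q : P}, p ≤ q → Prop} {M : GrMod S} :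
    GrMod.extOn S W M ↔ M.diag.IsExtOn W := by
  simp only [extOn, isExtension_iff, GrDiag.IsExtOn]

/-- A coreflection of `M` is a terminal object among the modules of the class over `M`, and terminal
objects for all `M` assemble into a right adjoint. -/
theorem TorusModel.GrMod.isLeftAdjoint_extOn_ι (W : ∀ {p q : P}, p ≤ q → Prop) :
    (GrMod.extOn S W).ι.IsLeftAdjoint := by
  have : ∀ M : GrMod S, Limits.HasTerminal (CostructuredArrow (GrMod.extOn S W).ι M) := by
    intro M
    obtain ⟨Γ, ε, hΓ, h⟩ := GrDiag.exists_coreflection W M.diag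
    let Γ' : (GrMod.extOn S W).FullSubcategory := ⟨Γ.toGrMod, GrMod.extOn_iff.mpr hΓ⟩
    let T : CostructuredArrow (GrMod.extOn S W).ι M :=
      CostructuredArrow.mk (Y := Γ') ((GrMod.homEquivDiag Γ.toGrMod M).symm ε)
    have hT : ∀ X : CostructuredArrow (GrMod.extOn S W).ι M, ∃! g : X.left ⟶ Γ',
        (GrMod.extOn S W).ι.map g ≫ T.hom = X.hom := by
      intro X
      obtain ⟨g, hg, hg'⟩ := h X.left.obj.diag (GrMod.extOn_iff.mp X.left.property)
        (GrMod.homEquivDiag _ _ X.hom)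
      refine ⟨ObjectProperty.homMk ((GrMod.homEquivDiag _ Γ.toGrMod).symm g),
        (GrMod.homEquivDiag _ _).injective hg, fun k hk => ?_⟩
      apply ObjectProperty.hom_ext
      apply (GrMod.homEquivDiag _ _).injective
      exact hg' _ (congrArg (GrMod.homEquivDiag _ _) hk)
    have ht : Limits.IsTerminal T := Limits.IsTerminal.ofUniqueHom
      (fun X => CostructuredArrow.homMk (hT X).choose (hT X).choose_spec.1)
      (fun X m => by
        ext1
        exact (hT X).choose_spec.2 _ (CostructuredArrow.w m))
    exact ht.hasTerminal
  exact isLeftAdjoint_of_costructuredArrowTerminals _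

/-- Right adjoints to the inclusions of a property and of a stronger one, obtained from right
adjoints to the inclusions in the ambient category. -/
theorem exists_adjunctions {C : Type 1} [Category.{0} C] {Q R : ObjectProperty C} (h : Q ≤ R)
    (hQ : Q.ι.IsLeftAdjoint) (hR : R.ι.IsLeftAdjoint) :
    ∃ (Γv : C ⥤ R.FullSubcategory) (Γh : R.FullSubcategory ⥤ Q.FullSubcategory),
      Nonempty (R.ι ⊣ Γv) ∧ Nonempty (ObjectProperty.ιOfLE h ⊣ Γh) ∧ Nonempty (Q.ι ⊣ Γv ⋙ Γh) := by
  -- Since `R` is a full subcategory containing `Q`, the coreflection onto `Q` restricted to `R` is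
  -- right adjoint to the inclusion of `Q` in `R`.
  let adj : ObjectProperty.ιOfLE h ⊣ R.ι ⋙ Q.ι.rightAdjoint :=
    (Adjunction.ofIsLeftAdjoint Q.ι).restrictFullyFaithful
      (iC := 𝟭 Q.FullSubcategory) (iD := R.ι) (Functor.FullyFaithful.id _) R.fullyFaithfulι
      (Iso.refl _) (Iso.refl _)
  exact ⟨R.ι.rightAdjoint, _, ⟨Adjunction.ofIsLeftAdjoint R.ι⟩, ⟨adj⟩,
    ⟨adj.comp (Adjunction.ofIsLeftAdjoint R.ι)⟩⟩

end Adjunctions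

theorem mainTheorem3 (r : ℕ) (G : Type) [CommGroup G] [TopologicalSpace G] [IsTopologicalGroup G]
    [CompactSpace G] [T2Space G] (hG : Nonempty (G ≃ₜ* (Fin r → Circle)))
    (A : Type) [AddCommGroup A] (c : A) :
    (∃ (Γcv : GrMod (Rcp G c) ⥤ (eP G c).FullSubcategory)
        (Γch : (eP G c).FullSubcategory ⥤ (qceP G c).FullSubcategory),
      Nonempty ((eP G c).ι ⊣ Γcv) ∧
      Nonempty (ObjectProperty.ιOfLE (qceP_le_eP G c) ⊣ Γch) ∧
      Nonempty ((qceP G c).ι ⊣ Γcv ⋙ Γch)) ∧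
    (∃ (Γcv : GrMod (Rcf G c) ⥤ (eF G c).FullSubcategory)
        (Γch : (eF G c).FullSubcategory ⥤ (qceF G c).FullSubcategory),
      Nonempty ((eF G c).ι ⊣ Γcv) ∧
      Nonempty (ObjectProperty.ιOfLE (qceF_le_eF G c) ⊣ Γch) ∧
      Nonempty ((qceF G c).ι ⊣ Γcv ⋙ Γch)) := by
  -- Each property is matched with its class `W`: vertical maps, vertical or horizontal maps,
  -- inclusions of the first element of a flag, and all maps.
  have e1 : eP G c = GrMod.extOn (Rcp G c) fun {p q} _ => p.fst = q.fst := rfl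
  have e2 : qceP G c = GrMod.extOn (Rcp G c) fun {p q} _ => p.snd = q.snd ∨ p.fst = q.fst := by
    ext M
    exact ⟨fun h p q hpq => Or.rec (h.1 p q hpq) (h.2 p q hpq),
      fun h => ⟨fun p q hpq e => h p q hpq (Or.inl e), fun p q hpq e => h p q hpq (Or.inr e)⟩⟩
  have e3 : eF G c = GrMod.extOn (Rcf G c) fun {E F} _ => E = Flags.singleton F.first := by
    ext M
    refine ⟨fun h E F hEF e => ?_, fun h F => h _ F F.singleton_first_le rfl⟩
    cases e
    exact h F
  have e4 : qceF G c = GrMod.extOn (Rcf G c) fun _ => True := by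
    ext M
    exact ⟨fun h E F hEF _ => h E F hEF, fun h E F hEF => h E F hEF trivial⟩
  constructor
  · refine exists_adjunctions (qceP_le_eP G c) ?_ ?_
    · rw [e2]; exact GrMod.isLeftAdjoint_extOn_ι _
    · rw [e1]; exact GrMod.isLeftAdjoint_extOn_ι _
  · refine exists_adjunctions (qceF_le_eF G c) ?_ ?_
    · rw [e4]; exact GrMod.isLeftAdjoint_extOn_ι _
    · rw [e3]; exact GrMod.isLeftAdjoint_extOn_ι _
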